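/- \textbf{Theorem.} Let $A$ be a $C^*$-algebra, let $H$ be a Hilbert $A$-module, and let $P$ be a regular self-adjoint (in general unbounded) operator on $H$. Let $\pi : C_0(\mathbb{R})\to\mathcal{L}(H)$ be the functional calculus of $P$, that is, the unique nondegenerate representation whose extension $\widetilde\pi(F)=F\otimes_\pi \mathrm{Id}$ to functions $F\in C(\mathbb{R})$ (with $C_0(\mathbb{R})\otimes_\pi H\simeq H$) satisfies $\widetilde\pi(\mathrm{Id}_{\mathbb{R}})=P$, and put $e^{-itP}=\widetilde\pi(f_t)$ with $f_t(\lambda)=e^{-it\lambda}$, for $t\in\mathbb{R}$. For an integer $m\ge 0$ let $H^m=\operatorname{dom}(P^m)$ (so $H^0=H$), with the norm given by the $A$-valued inner product $\langle u,v\rangle_m=\langle(1+P^2)^m u,v\rangle=\sum_{l=0}^m\binom{m}{l}\langle P^l u,P^l v\rangle$ (the sum being the extension of the middle expression to $\operatorname{dom}(P^m)$). Let $k$ be a positive integer. For any $f\in C^{k-1}(\mathbb{R},H^k)$ and $g\in H^k$, the Cauchy problem $$\Big(\frac{\partial}{\partial t}+iP\Big)u=f,\qquad u(0)=g$$ has a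 unique solution $u$ in $\bigcap_{0\le j\le k}C^j(\mathbb{R},H^{k-j})$, and it is given by $$u(t)=e^{-itP}g+\int_0^t e^{i(s-t)P}f(s)\,ds\qquad(t\in\mathbb{R}),$$ where the integrand is Bochner integrable in $H$ on $[0,t]$. -/

import Mathlib

open scoped ZeroAtInfty WithCStarModule

namespace HilbertModule

section Operators

variable (A : Type*) [NonUnitalCStarAlgebra A] [PartialOrder A] [StarOrderedRing A]
variable {H : Type*} [NormedAddCommGroup H] [NormedSpace ℂ H] [SMul A H] [CStarModule A H]

/-- The graph of the adjoint `T*` of an unbounded operator `T` on a Hilbert `A`-module: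
the pairs `(y, z)` with `⟪T x, y⟫ = ⟪x, z⟫` for all `x ∈ dom T`.
(It is the graph of a map as soon as `dom T` is dense.) -/
def adjointGraph (T : H →ₗ.[ℂ] H) : Submodule ℂ (H × H) where
  carrier := {p | ∀ x : T.domain, inner A (T x) p.1 = inner A (x : H) p.2}
  add_mem' := by
    intro p q hp hq x
    simp [hp x, hq x]
  zero_mem' := by
    intro x
    simp
  smul_mem' := by
    intro c p hp x
    simp [hp x]

/-- Regular operators on a Hilbert `A`-module: closed, densely defined, `A`-linear operators `T`
whose adjoint is densely defined and such that `1 + T* T` has dense range. -/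
structure IsRegular (T : H →ₗ.[ℂ] H) : Prop where
  isClosed : T.IsClosed
  dense_domain : Dense (T.domain : Set H)
  smul_map : ∀ (a : A) (x : T.domain),
    ∃ h : a • (x : H) ∈ T.domain, T ⟨a • (x : H), h⟩ = a • T x
  dense_adjoint_domain : Dense {y : H | ∃ z : H, (y, z) ∈ adjointGraph A T}
  dense_range : Dense {y : H | ∃ (x : T.domain) (z : H),
    (T x, z) ∈ adjointGraph A T ∧ y = (x : H) + z}

/-- Self-adjointness of a densely defined operator: `T = T*`, domains included. -/
structure IsSelfAdjoint (T : H →ₗ.[ℂ] H) : Prop where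
  dense_domain : Dense (T.domain : Set H)
  graph_eq : T.graph = adjointGraph A T

end Operators

section Powers

variable {H : Type*} [AddCommGroup H] [Module ℂ H]

/-- The composition `S ∘ T` of unbounded operators, with its natural domain
`{x ∈ dom T | T x ∈ dom S}`. -/
def pcomp (S T : H →ₗ.[ℂ] H) : H →ₗ.[ℂ] H where
  domain := (S.domain.comap T.toFun).map T.domain.subtype
  toFun :=
    { toFun := fun x => S ⟨T ⟨x, by
          obtain ⟨y, -, hy⟩ := x.2
          rw [← hy]; exact y.2⟩, by
          obtain ⟨x, y, hy, rfl⟩ := x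
          exact hy⟩
      map_add' := by
        intro x y
        rw [← LinearPMap.map_add]
        congr 1
        apply Subtype.ext
        exact T.map_add ⟨x, _⟩ ⟨y, _⟩
      map_smul' := by
        intro c x
        rw [RingHom.id_apply, ← LinearPMap.map_smul]
        congr 1
        apply Subtype.ext
        exact T.map_smul c ⟨x, _⟩ }

/-- The powers `P^k` of an unbounded operator, with their natural domains:
`dom P^(k+1) = {x ∈ dom P^k | P^k x ∈ dom P}`. -/
def ppow (P : H →ₗ.[ℂ] H) : ℕ → (H →ₗ.[ℂ] H)
  | 0 => LinearMap.id.toPMap ⊤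
  | k + 1 => pcomp P (ppow P k)

theorem ppow_domain_antitone (P : H →ₗ.[ℂ] H) : Antitone fun k => (ppow P k).domain := by
  refine antitone_nat_of_succ_le fun k => ?_
  rintro x ⟨y, -, rfl⟩
  exact y.2

end Powers

section Sobolev

variable (A : Type*) [NonUnitalCStarAlgebra A] [PartialOrder A] [StarOrderedRing A]
variable {H : Type*} [NormedAddCommGroup H] [NormedSpace ℂ H] [SMul A H] [CStarModule A H]

/-- The Sobolev module `H^k = dom P^k` of `P`, normed by means of the inner product
`⟪u, v⟫_k = ⟪(1 + P²)^k u, v⟫ = ∑_{m ≤ k} (k choose m) ⟪P^m u, P^m v⟫`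
(the sum extends the middle expression from `dom P^(2k)` to `dom P^k` when `P` is symmetric);
see `SobolevModule.norm_eq`. -/
@[nolint unusedArguments]
def SobolevModule (_A : Type*) (P : H →ₗ.[ℂ] H) (k : ℕ) : Type _ := (ppow P k).domain

namespace SobolevModule

variable {A}
variable {P : H →ₗ.[ℂ] H} {k : ℕ}

instance : AddCommGroup (SobolevModule A P k) :=
  inferInstanceAs (AddCommGroup (ppow P k).domain)

instance : Module ℂ (SobolevModule A P k) :=
  inferInstanceAs (Module ℂ (ppow P k).domain)

/-- The inclusion `H^k → H`. -/
def incl : SobolevModule A P k →ₗ[ℂ] H := (ppow P k).domain.subtype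

/-- The operator `P^m : H^k → H`, for `m ≤ k`. -/
def powMap (m : Fin (k + 1)) : SobolevModule A P k →ₗ[ℂ] H :=
  (ppow P m).toFun.comp
    (Submodule.inclusion (ppow_domain_antitone P (Nat.lt_succ_iff.mp m.2)))

/-- The map `u ↦ ((k choose m)^(1/2) P^m u)_{m ≤ k}` into the Hilbert `A`-module `H^(k+1)`,
which is used to define the norm of the Sobolev module. -/
noncomputable def embed : SobolevModule A P k →ₗ[ℂ] C⋆ᵐᵒᵈ(A, Fin (k + 1) → H) where
  toFun u := (WithCStarModule.equiv A (Fin (k + 1) → H)).symm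
    fun m => ((√(k.choose m : ℝ) : ℝ) : ℂ) • powMap m u
  map_add' u v := by ext m; simp
  map_smul' c u := by ext m; simp [smul_comm c]

theorem embed_injective : Function.Injective (embed (A := A) (P := P) (k := k)) := by
  intro u v h
  have h0 : powMap (A := A) (P := P) (k := k) 0 u = powMap 0 v := by
    have := congrArg (fun w => WithCStarModule.equiv A (Fin (k + 1) → H) w 0) h
    simpa [embed] using this
  exact Subtype.ext h0

noncomputable instance : NormedAddCommGroup (SobolevModule A P k) :=
  NormedAddCommGroup.induced _ _ (embed (A := A) (P := P) (k := k)) embed_injective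

noncomputable instance : NormedSpace ℂ (SobolevModule A P k) :=
  NormedSpace.induced ℂ _ _ (embed (A := A) (P := P) (k := k))

theorem norm_eq (u : SobolevModule A P k) :
    ‖u‖ = √‖∑ m : Fin (k + 1), (k.choose m : ℝ) • inner A (powMap m u) (powMap m u)‖ := by
  change ‖embed u‖ = _
  rw [WithCStarModule.pi_norm]
  congr 2
  refine Finset.sum_congr rfl fun m _ => ?_
  have h : (embed u) m = (√(k.choose m : ℝ) : ℝ) • powMap m u := rfl
  rw [h, CStarModule.inner_smul_left_real, CStarModule.inner_smul_right_real, smul_smul,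
    Real.mul_self_sqrt (Nat.cast_nonneg _)]

end SobolevModule

/-- `u ∈ C^j(ℝ, H^m)`: the function `u` takes its values in the Sobolev module `H^m` of `P`, and is
of class `C^j` for the norm of `H^m`. -/
def MemC (P : H →ₗ.[ℂ] H) (j m : ℕ) (u : ℝ → H) : Prop :=
  ∃ v : ℝ → SobolevModule A P m, ContDiff ℝ j v ∧ ∀ t, SobolevModule.incl (v t) = u t

end Sobolev

section FunctionalCalculus

variable (A : Type*) [NonUnitalCStarAlgebra A] [PartialOrder A] [StarOrderedRing A]
variable {H : Type*} [NormedAddCommGroup H] [NormedSpace ℂ H] [SMul A H] [CStarModule A H]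

/-- Nondegenerate representations `π : C₀(ℝ) → 𝓛(H)` on the Hilbert `A`-module `H`:
multiplicative linear maps such that `π(φ)` is adjointable with adjoint `π(φ̄)`, and such that
`π(C₀(ℝ)) H` spans a dense subspace. -/
structure IsNondegenerateRep (π : C₀(ℝ, ℂ) →ₙₐ[ℂ] (H →L[ℂ] H)) : Prop where
  adjoint : ∀ (φ : C₀(ℝ, ℂ)) (x y : H), inner A (π φ x) y = inner A x (π (star φ) y)
  nondegenerate :
    Dense (Submodule.span ℂ {y : H | ∃ (φ : C₀(ℝ, ℂ)) (x : H), π φ x = y} : Set H)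

/-- The graph of `π̃(F) = F ⊗_π Id` for `F ∈ C(ℝ)`, under `C₀(ℝ) ⊗_π H ≃ H`, `φ ⊗ x ↦ π(φ) x`.
Here `F` is the regular operator of multiplication by `F` on `C₀(ℝ)`, with domain
`{φ ∈ C₀(ℝ) | F φ ∈ C₀(ℝ)}`, and `F ⊗_π Id` is the closure of the operator
`φ ⊗ x ↦ (F φ) ⊗ x` on the span of the elementary tensors with `φ` in this domain. -/
def extensionGraph (π : C₀(ℝ, ℂ) →ₙₐ[ℂ] (H →L[ℂ] H)) (F : C(ℝ, ℂ)) : Submodule ℂ (H × H) :=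
  (Submodule.span ℂ {p : H × H | ∃ (φ ψ : C₀(ℝ, ℂ)) (x : H),
    (∀ r : ℝ, ψ r = F r * φ r) ∧ p = (π φ x, π ψ x)}).topologicalClosure

/-- `π` is the functional calculus of `P`: a nondegenerate representation of `C₀(ℝ)` whose
extension to `C(ℝ)` sends the function `r ↦ r` to `P`. -/
structure IsFunctionalCalculus (P : H →ₗ.[ℂ] H) (π : C₀(ℝ, ℂ) →ₙₐ[ℂ] (H →L[ℂ] H)) : Prop where
  rep : IsNondegenerateRep A π
  extension_id : extensionGraph π ⟨fun r : ℝ => (r : ℂ), Complex.continuous_ofReal⟩ = P.graph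

open Classical in
/-- The functional calculus `π : C₀(ℝ) → 𝓛(H)` of `P`. A regular self-adjoint operator has exactly
one; the value `0` is used for operators that have none. -/
noncomputable def functionalCalculus (P : H →ₗ.[ℂ] H) : C₀(ℝ, ℂ) →ₙₐ[ℂ] (H →L[ℂ] H) :=
  if h : ∃ π, IsFunctionalCalculus A P π then h.choose else 0

/-- The function `f_t(r) = e^{-itr}` on the real line. -/
noncomputable def expFun (t : ℝ) : C(ℝ, ℂ) :=
  ⟨fun r : ℝ => Complex.exp (-(Complex.I * t * r)), by fun_prop⟩

/-- The operator `e^{-itP} = π̃(f_t)` given by the functional calculus `π` of `P`. -/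
noncomputable def expOp (P : H →ₗ.[ℂ] H) (t : ℝ) : H →ₗ.[ℂ] H :=
  (extensionGraph (functionalCalculus A P) (expFun t)).toLinearPMap

open Classical in
/-- The vector `e^{-itP} x` (the operator `e^{-itP}` of a regular self-adjoint `P` is defined
everywhere; the value is `0` outside the domain). -/
noncomputable def expNegI (P : H →ₗ.[ℂ] H) (t : ℝ) (x : H) : H :=
  if hx : x ∈ (expOp A P t).domain then expOp A P t ⟨x, hx⟩ else 0

end FunctionalCalculus

section CauchyProblem

variable {H : Type*} [NormedAddCommGroup H] [NormedSpace ℂ H]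

/-- `u` solves the Cauchy problem `(∂_t + iP) u = f`, `u(0) = g`. -/
def SolvesCauchy (P : H →ₗ.[ℂ] H) (f : ℝ → H) (g : H) (u : ℝ → H) : Prop :=
  (∀ t : ℝ, ∃ (ht : u t ∈ P.domain) (u' : H),
    HasDerivAt u u' t ∧ u' + Complex.I • P ⟨u t, ht⟩ = f t) ∧ u 0 = g

end CauchyProblem

end HilbertModule

set_option linter.unusedSectionVars false

/-! Everything rests on the strongly continuous group of isometries `U_t = e^{-itP}`, which
preserves the graph of `P` and satisfies `d/dt U_t x = -i U_t P x` on `dom P` (`IsUnitaryGroupOf`).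
For any solution `u`, the function `U_{-s} u(s)` has derivative `U_{-s} f(s)`; integrating forces
Duhamel's formula, hence uniqueness (`eq_of_solvesCauchy`). Conversely, a closed `P` passes under
the integral, so `P^l` of the Duhamel function is the Duhamel function of `P^l f` and `P^l g`. The
equation `u' = f - iPu` then trades one time derivative for one power of `P`, and regularity follows
by induction (`contDiff_duhamel`).

The group comes from the functional calculus. Regularity makes `P ± i` bijections of `dom P` onto
`H`, so the Cayley transform is a unitary of the C⋆-algebra of adjointable operators. Its continuous
functional calculus, pulled back from the circle to the line, is a representation whose extension
sends `r` to `P` (`isFunctionalCalculus_cayleyRep`). For any such `π`, `|f_t| = 1` makes `π̃(f_t)`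
an everywhere defined isometry. The group law, strong continuity and generator are checked on
vectors `π(φ) x`, where they are statements about functions, and extended by density or closedness.
-/

namespace HilbertModule

/-! ### The C⋆-algebra of adjointable operators. -/

section Adjointable

variable (A : Type*) [NonUnitalCStarAlgebra A] [PartialOrder A] [StarOrderedRing A]
variable (H : Type*) [NormedAddCommGroup H] [NormedSpace ℂ H] [SMul A H] [CStarModule A H]

variable {H} in
/-- `S` is an adjoint of the bounded operator `T` on a Hilbert `A`-module. -/
def IsAdjointOf (S T : H →L[ℂ] H) : Prop :=
  ∀ x y : H, inner A (T x) y = inner A x (S y)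

variable {A H} in
theorem ext_inner {x y : H} (h : ∀ z : H, inner A z x = inner A z y) : x = y := by
  rw [← sub_eq_zero, ← CStarModule.inner_self (A := A), CStarModule.inner_sub_right, h, sub_self]

namespace IsAdjointOf

variable {A H} {S T S' T' : H →L[ℂ] H}

theorem unique (h : IsAdjointOf A S T) (h' : IsAdjointOf A S' T) : S = S' := by
  ext y
  exact ext_inner (A := A) fun x => by rw [← h, ← h']

theorem symm (h : IsAdjointOf A S T) : IsAdjointOf A T S := fun x y => by
  rw [← CStarModule.star_inner, ← h, CStarModule.star_inner]

theorem add (h : IsAdjointOf A S T) (h' : IsAdjointOf A S' T') :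
    IsAdjointOf A (S + S') (T + T') := fun x y => by
  simp [h x y, h' x y]

theorem sub (h : IsAdjointOf A S T) (h' : IsAdjointOf A S' T') :
    IsAdjointOf A (S - S') (T - T') := fun x y => by
  simp [h x y, h' x y]

theorem mul (h : IsAdjointOf A S T) (h' : IsAdjointOf A S' T') :
    IsAdjointOf A (S' * S) (T * T') := fun x y => by
  simp [h _ y, h' x _]

theorem smul (c : ℂ) (h : IsAdjointOf A S T) : IsAdjointOf A (star c • S) (c • T) := fun x y => by
  simp [h x y]

theorem one : IsAdjointOf A (1 : H →L[ℂ] H) 1 := fun _ _ => rfl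

/-- Cauchy–Schwarz applied to `⟪T x, T x⟫ = ⟪x, S T x⟫`; this is the C⋆-inequality. -/
theorem norm_mul_self_le (h : IsAdjointOf A S T) : ‖T‖ * ‖T‖ ≤ ‖S * T‖ := by
  rw [← sq, ← Real.sqrt_le_sqrt_iff (norm_nonneg _), Real.sqrt_sq (norm_nonneg _)]
  refine T.opNorm_le_bound (Real.sqrt_nonneg _) fun x => ?_
  rw [← Real.sqrt_sq (norm_nonneg x), ← Real.sqrt_mul (norm_nonneg _)]
  refine Real.le_sqrt_of_sq_le ?_
  rw [CStarModule.norm_sq_eq A, h]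
  calc ‖inner A x (S (T x))‖ ≤ ‖x‖ * ‖(S * T) x‖ := CStarModule.norm_inner_le H
    _ ≤ ‖x‖ * (‖S * T‖ * ‖x‖) := by gcongr; exact (S * T).le_opNorm x
    _ = ‖S * T‖ * ‖x‖ ^ 2 := by ring

theorem norm_le (h : IsAdjointOf A S T) : ‖T‖ ≤ ‖S‖ := by
  have h1 := h.norm_mul_self_le.trans (norm_mul_le S T)
  rcases (norm_nonneg T).eq_or_lt with h0 | h0
  · rw [← h0]; exact norm_nonneg _
  · exact le_of_mul_le_mul_right h1 h0

end IsAdjointOf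

/-- The subalgebra of adjointable operators in the bounded operators on a Hilbert `A`-module. -/
def adjointableSubalgebra : Subalgebra ℂ (H →L[ℂ] H) where
  carrier := {T | ∃ S, IsAdjointOf A S T}
  mul_mem' := fun ⟨_, h⟩ ⟨_, h'⟩ => ⟨_, h.mul h'⟩
  add_mem' := fun ⟨_, h⟩ ⟨_, h'⟩ => ⟨_, h.add h'⟩
  algebraMap_mem' c := ⟨_, by simpa [Algebra.algebraMap_eq_smul_one] using IsAdjointOf.one.smul c⟩

/-- The C⋆-algebra `𝓛(H)` of adjointable operators on a Hilbert `A`-module `H`. -/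
def Adjointable : Type _ := adjointableSubalgebra A H

namespace Adjointable

variable {A H}

noncomputable instance : NormedRing (Adjointable A H) :=
  inferInstanceAs (NormedRing (adjointableSubalgebra A H))

noncomputable instance : NormedAlgebra ℂ (Adjointable A H) :=
  inferInstanceAs (NormedAlgebra ℂ (adjointableSubalgebra A H))

variable (A H) in
/-- The inclusion of the adjointable operators into the bounded operators. -/
def toCLM : Adjointable A H →ₐ[ℂ] (H →L[ℂ] H) := (adjointableSubalgebra A H).val

noncomputable instance : Star (Adjointable A H) where
  star T := ⟨T.2.choose, T.1, T.2.choose_spec.symm⟩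

theorem isAdjointOf_star (T : Adjointable A H) :
    IsAdjointOf A (star T : Adjointable A H).1 T.1 := T.2.choose_spec

theorem star_eq_of_isAdjointOf {S T : Adjointable A H} (h : IsAdjointOf A S.1 T.1) : star T = S :=
  Subtype.ext ((isAdjointOf_star T).unique h)

noncomputable instance : StarRing (Adjointable A H) where
  star_involutive T := star_eq_of_isAdjointOf (isAdjointOf_star T).symm
  star_mul S T := star_eq_of_isAdjointOf ((isAdjointOf_star S).mul (isAdjointOf_star T))
  star_add S T := star_eq_of_isAdjointOf ((isAdjointOf_star S).add (isAdjointOf_star T))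

instance : StarModule ℂ (Adjointable A H) where
  star_smul c T := star_eq_of_isAdjointOf ((isAdjointOf_star T).smul c)

instance : CStarRing (Adjointable A H) where
  norm_mul_self_le T := (isAdjointOf_star T).norm_mul_self_le

variable [CompleteSpace H]

-- Taking adjoints does not increase the norm, so the adjoints of a convergent sequence are Cauchy,
-- and their limit is an adjoint of the limit.
variable (A H) in
theorem isClosed : IsClosed (adjointableSubalgebra A H : Set (H →L[ℂ] H)) := by
  refine IsSeqClosed.isClosed fun T T₀ hT hlim => ?_
  choose S hS using hT
  have hcauchy : CauchySeq S := by
    have hc := Metric.cauchySeq_iff'.mp hlim.cauchySeq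
    refine Metric.cauchySeq_iff'.mpr fun ε hε => (hc ε hε).imp fun N hN n hn => ?_
    refine lt_of_le_of_lt ?_ (hN n hn)
    rw [dist_eq_norm, dist_eq_norm]
    exact ((hS n).sub (hS N)).symm.norm_le
  obtain ⟨S₀, hS₀⟩ := cauchySeq_tendsto_of_complete hcauchy
  refine ⟨S₀, fun x y => ?_⟩
  have hTx := ((ContinuousLinearMap.apply ℂ H x).continuous.tendsto T₀).comp hlim
  have hSy := ((ContinuousLinearMap.apply ℂ H y).continuous.tendsto S₀).comp hS₀
  have h1 := ((CStarModule.continuous_inner (A := A) (E := H)).tendsto (T₀ x, y)).comp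
    (hTx.prodMk_nhds tendsto_const_nhds)
  have h2 := ((CStarModule.continuous_inner (A := A) (E := H)).tendsto (x, S₀ y)).comp
    ((tendsto_const_nhds (x := x)).prodMk_nhds hSy)
  refine tendsto_nhds_unique h1 (h2.congr fun n => ?_)
  exact (hS n x y).symm

instance : CompleteSpace (Adjointable A H) := (isClosed A H).completeSpace_coe

noncomputable instance : CStarAlgebra (Adjointable A H) where

end Adjointable

end Adjointable

/-! ### Resolvents at `± i` and the Cayley transform. -/

section Resolvent

variable {A : Type*} [NonUnitalCStarAlgebra A] [PartialOrder A] [StarOrderedRing A]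
variable {H : Type*} [NormedAddCommGroup H] [NormedSpace ℂ H] [SMul A H] [CStarModule A H]
variable {P : H →ₗ.[ℂ] H}

theorem IsSelfAdjoint.symmetric (h : IsSelfAdjoint A P) {p q : H × H} (hp : p ∈ P.graph)
    (hq : q ∈ P.graph) : inner A p.2 q.1 = inner A p.1 q.2 := by
  obtain ⟨x, hx1, hx2⟩ := (LinearPMap.mem_graph_iff P).mp hp
  rw [h.graph_eq] at hq
  rw [← hx1, ← hx2]
  exact hq x

theorem norm_le_norm_of_inner_le {x y : H}
    (h : (inner A x x : A) ≤ inner A y y) : ‖x‖ ≤ ‖y‖ := by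
  rw [CStarModule.norm_eq_sqrt_norm_inner_self (A := A) x,
    CStarModule.norm_eq_sqrt_norm_inner_self (A := A) y]
  exact Real.sqrt_le_sqrt
    (CStarAlgebra.norm_le_norm_of_nonneg_of_le CStarModule.inner_self_nonneg h)

/-- The two points `c = ± i` are treated together: the computations need only `c̄ = -c` and `c² =
-1`. -/
theorem star_eq_neg_of_mem {c : ℂ} (hc : c = Complex.I ∨ c = -Complex.I) : star c = -c := by
  rcases hc with rfl | rfl <;> simp

theorem mul_self_of_mem {c : ℂ} (hc : c = Complex.I ∨ c = -Complex.I) : c * c = -1 := by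
  rcases hc with rfl | rfl <;> simp

theorem neg_mem_of_mem {c : ℂ} (hc : c = Complex.I ∨ c = -Complex.I) :
    -c = Complex.I ∨ -c = -Complex.I := by
  rcases hc with rfl | rfl <;> simp

/-- Symmetry of `P` and `c̄ = -c` make the cross terms cancel, a Pythagorean identity that bounds `P
+ c` from below in the graph norm. -/
theorem IsSelfAdjoint.inner_add_smul (h : IsSelfAdjoint A P) {c : ℂ}
    (hc : c = Complex.I ∨ c = -Complex.I) {p : H × H} (hp : p ∈ P.graph) :
    (inner A (p.2 + c • p.1) (p.2 + c • p.1) : A) = inner A p.2 p.2 + inner A p.1 p.1 := by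
  simp only [CStarModule.inner_add_left, CStarModule.inner_add_right,
    CStarModule.inner_smul_left_complex, CStarModule.inner_smul_right_complex, smul_add,
    h.symmetric hp hp, star_eq_neg_of_mem hc, neg_smul, smul_neg]
  rw [smul_smul, mul_self_of_mem hc, neg_one_smul]
  abel

theorem IsSelfAdjoint.norm_le_norm_add_smul (h : IsSelfAdjoint A P) {c : ℂ}
    (hc : c = Complex.I ∨ c = -Complex.I) {p : H × H} (hp : p ∈ P.graph) :
    ‖p‖ ≤ ‖p.2 + c • p.1‖ := by
  refine max_le ?_ ?_ <;> refine norm_le_norm_of_inner_le (A := A) ?_ <;>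
    rw [h.inner_add_smul hc hp]
  · exact le_add_of_nonneg_left CStarModule.inner_self_nonneg
  · exact le_add_of_nonneg_right CStarModule.inner_self_nonneg

/-- The map `(x, P x) ↦ P x + c x` on the graph of `P`. -/
noncomputable def graphAddSMul (P : H →ₗ.[ℂ] H) (c : ℂ) : P.graph →L[ℂ] H :=
  (ContinuousLinearMap.snd ℂ H H + c • ContinuousLinearMap.fst ℂ H H) ∘L P.graph.subtypeL

theorem graphAddSMul_apply (c : ℂ) (p : P.graph) :
    graphAddSMul P c p = (p : H × H).2 + c • (p : H × H).1 := rfl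

variable [CompleteSpace H]

theorem antilipschitz_graphAddSMul (h : IsSelfAdjoint A P) {c : ℂ}
    (hc : c = Complex.I ∨ c = -Complex.I) : AntilipschitzWith 1 (graphAddSMul P c) :=
  AddMonoidHomClass.antilipschitz_of_bound _ fun p => by
    rw [NNReal.coe_one, one_mul, graphAddSMul_apply]
    exact h.norm_le_norm_add_smul hc p.2

theorem IsRegular.completeSpace_graph (hP : IsRegular A P) : CompleteSpace P.graph :=
  hP.isClosed.completeSpace_coe

/-- The range is closed, because the map is bounded below on a complete graph. It is dense because
`1 + P* P = (P + c)(P - c)` has dense range by regularity. -/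
theorem range_graphAddSMul (hP : IsRegular A P) (h : IsSelfAdjoint A P) {c : ℂ}
    (hc : c = Complex.I ∨ c = -Complex.I) : Set.range (graphAddSMul P c) = Set.univ := by
  have := hP.completeSpace_graph
  have hcl := (antilipschitz_graphAddSMul h hc).isClosed_range (graphAddSMul P c).uniformContinuous
  rw [← hcl.closure_eq, ← dense_iff_closure_eq]
  refine hP.dense_range.mono ?_
  rintro y ⟨x, z, hz, rfl⟩
  rw [← h.graph_eq] at hz
  -- The preimage of `x + P² x` is the graph point over `P x - c x`.
  refine ⟨⟨(P x, z) - c • ((x : H), P x), sub_mem hz (P.graph.smul_mem _ (P.mem_graph x))⟩, ?_⟩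
  simp only [graphAddSMul_apply, Prod.snd_sub, Prod.smul_snd, Prod.fst_sub, Prod.smul_fst,
    smul_sub, smul_smul, mul_self_of_mem hc, neg_smul, one_smul]
  abel

/-- For `c = ± i`, the bijection `(x, P x) ↦ P x + c x` from the graph of a regular self-adjoint
operator onto `H`. -/
noncomputable def graphEquiv (hP : IsRegular A P) (h : IsSelfAdjoint A P) {c : ℂ}
    (hc : c = Complex.I ∨ c = -Complex.I) : P.graph ≃L[ℂ] H :=
  have := hP.completeSpace_graph
  ContinuousLinearEquiv.ofBijective (graphAddSMul P c)
    (LinearMap.ker_eq_bot.mpr (antilipschitz_graphAddSMul h hc).injective)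
    (LinearMap.range_eq_top.mpr (Set.range_eq_univ.mp (range_graphAddSMul hP h hc)))

/-- The resolvent `(P + c)⁻¹`, for `c = ± i`. -/
noncomputable def resolvent (hP : IsRegular A P) (h : IsSelfAdjoint A P) {c : ℂ}
    (hc : c = Complex.I ∨ c = -Complex.I) : H →L[ℂ] H :=
  ContinuousLinearMap.fst ℂ H H ∘L P.graph.subtypeL ∘L (graphEquiv hP h hc).symm

variable (hP : IsRegular A P) (h : IsSelfAdjoint A P) {c : ℂ}
  (hc : c = Complex.I ∨ c = -Complex.I)

include hP h hc in
theorem exists_mem_graph_eq_add_smul (y : H) : ∃ p ∈ P.graph, p.2 + c • p.1 = y := by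
  have hy : y ∈ Set.range (graphAddSMul P c) := by simp [range_graphAddSMul hP h hc]
  obtain ⟨p, hp⟩ := hy
  exact ⟨p, p.2, hp⟩

theorem resolvent_add_smul {p : H × H} (hp : p ∈ P.graph) :
    resolvent hP h hc (p.2 + c • p.1) = p.1 := by
  have : (graphEquiv hP h hc) ⟨p, hp⟩ = p.2 + c • p.1 := rfl
  rw [← this]
  simp [resolvent]

theorem resolvent_mem_graph (y : H) :
    (resolvent hP h hc y, y - c • resolvent hP h hc y) ∈ P.graph := by
  obtain ⟨p, hp, rfl⟩ := exists_mem_graph_eq_add_smul hP h hc y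
  rw [resolvent_add_smul hP h hc hp, add_sub_cancel_right]
  exact hp

theorem isAdjointOf_resolvent :
    IsAdjointOf A (resolvent hP h (neg_mem_of_mem hc)) (resolvent hP h hc) := by
  intro x y
  obtain ⟨p, hp, rfl⟩ := exists_mem_graph_eq_add_smul hP h hc x
  obtain ⟨q, hq, rfl⟩ := exists_mem_graph_eq_add_smul hP h (neg_mem_of_mem hc) y
  rw [resolvent_add_smul hP h _ hp, resolvent_add_smul hP h _ hq]
  simp only [CStarModule.inner_add_left, CStarModule.inner_add_right,
    CStarModule.inner_smul_left_complex, CStarModule.inner_smul_right_complex,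
    h.symmetric hp hq, star_eq_neg_of_mem hc]

/-- The resolvent `(P + c)⁻¹`, for `c = ± i`, as an adjointable operator. -/
noncomputable def resolventAdj : Adjointable A H :=
  ⟨resolvent hP h hc, _, isAdjointOf_resolvent hP h hc⟩

theorem star_resolventAdj :
    star (resolventAdj hP h hc) = resolventAdj hP h (neg_mem_of_mem hc) :=
  Adjointable.star_eq_of_isAdjointOf (isAdjointOf_resolvent hP h hc)

/-- The resolvent identity, from `P + c = (P - c) + 2c`. -/
theorem resolventAdj_neg_sub :
    resolventAdj hP h (neg_mem_of_mem hc) - resolventAdj hP h hc =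
      (2 * c) • (resolventAdj hP h (neg_mem_of_mem hc) * resolventAdj hP h hc) := by
  refine Subtype.ext (ContinuousLinearMap.ext fun y => ?_)
  change resolvent hP h _ y - resolvent hP h hc y =
    (2 * c) • resolvent hP h _ (resolvent hP h hc y)
  obtain ⟨p, hp, rfl⟩ := exists_mem_graph_eq_add_smul hP h hc y
  rw [resolvent_add_smul hP h hc hp, ← map_smul, sub_eq_iff_eq_add]
  have h2 := resolvent_add_smul hP h (neg_mem_of_mem hc) hp
  conv_rhs => rw [← h2, ← map_add]
  conv_rhs => rw [h2]
  congr 1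
  module

/-- The Cayley transform `(P - i)(P + i)⁻¹`. -/
noncomputable def cayley : Adjointable A H :=
  1 - (2 * Complex.I) • resolventAdj hP h (.inl rfl)

theorem star_cayley :
    star (cayley hP h) = 1 + (2 * Complex.I) • resolventAdj hP h (.inr rfl) := by
  rw [cayley, star_sub, star_one, star_smul, star_resolventAdj]
  simp

/-- In both products the linear terms cancel the quadratic one by the resolvent identity, used at `c
= i` and at `c = -i`. -/
theorem cayley_mem_unitary : cayley hP h ∈ unitary (Adjointable A H) := by
  have e1 := resolventAdj_neg_sub hP h (c := Complex.I) (.inl rfl)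
  have e2 := resolventAdj_neg_sub hP h (c := -Complex.I) (.inr rfl)
  simp only [neg_neg] at e2
  have hI : (2 * Complex.I) * (2 * Complex.I) = -4 := by
    linear_combination 4 * Complex.I_mul_I
  rw [Unitary.mem_iff, star_cayley, cayley]
  set R := resolventAdj hP h (.inl rfl)
  set S := resolventAdj hP h (.inr rfl)
  constructor
  · have : (1 + (2 * Complex.I) • S) * (1 - (2 * Complex.I) • R) =
        1 + (2 * Complex.I) • (S - R) - (2 * Complex.I * (2 * Complex.I)) • (S * R) := by
      simp only [mul_sub, add_mul, one_mul, mul_one, smul_mul_smul_comm, smul_sub]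
      abel
    rw [this, e1, smul_smul, add_sub_cancel_right]
  · have : (1 - (2 * Complex.I) • R) * (1 + (2 * Complex.I) • S) =
        1 - (2 * Complex.I) • (R - S) - (2 * Complex.I * (2 * Complex.I)) • (R * S) := by
      simp only [mul_add, sub_mul, one_mul, mul_one, smul_mul_smul_comm, smul_sub]
      abel
    rw [this, e2, smul_smul, mul_neg, mul_neg, neg_smul, sub_neg_eq_add, add_sub_cancel_right]

end Resolvent

/-! ### From functions on the line to functions on the circle. -/

section CayleyPullback

open Filter Topology

/-- The inverse `z ↦ i (1 + z) / (1 - z) = - Im z / (1 - Re z)` of the Cayley transform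
`r ↦ (r - i) / (r + i)` on the unit circle. -/
noncomputable def invCayley (z : ℂ) : ℝ := -z.im / (1 - z.re)

theorem re_ne_one_of_norm_eq_one {z : ℂ} (hz : ‖z‖ = 1) (h : z ≠ 1) : 1 - z.re ≠ 0 := by
  intro h0
  have h1 : z.re = 1 := by linarith
  have h2 := Complex.sq_norm z
  rw [hz, Complex.normSq_apply, h1] at h2
  have h3 : z.im = 0 := by
    have : z.im * z.im = 0 := by linarith
    exact mul_self_eq_zero.mp this
  exact h (Complex.ext h1 h3)

/-- Solve `z = 1 - 2i / (r + i)` for `(r + i)⁻¹`. This identity both matches the resolvent with the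
Cayley transform and shows that `r` blows up as `z → 1`. -/
theorem inv_invCayley_add_I {z : ℂ} (hz : ‖z‖ = 1) (h : z ≠ 1) :
    ((invCayley z : ℂ) + Complex.I)⁻¹ = (1 - z) / (2 * Complex.I) := by
  have h0 := re_ne_one_of_norm_eq_one hz h
  have h2 := Complex.sq_norm z
  rw [hz, Complex.normSq_apply] at h2
  have key : (1 - z) * ((invCayley z : ℂ) + Complex.I) = 2 * Complex.I := by
    have hk : invCayley z * (1 - z.re) = -z.im := div_mul_cancel₀ _ h0
    apply Complex.ext
    · simp
      linear_combination hk
    · simp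
      refine mul_left_cancel₀ h0 ?_
      linear_combination -z.im * hk - h2
  have h1 : (invCayley z : ℂ) + Complex.I ≠ 0 := by
    intro h3
    rw [h3, mul_zero] at key
    simp at key
  have hI : (2 * Complex.I : ℂ) ≠ 0 := by simp
  rw [inv_eq_iff_eq_inv, inv_div, eq_div_iff (sub_ne_zero.mpr h.symm), mul_comm, key]

theorem tendsto_invCayley {s : Set ℂ} (hs : s ⊆ Metric.sphere 0 1) {z₀ : s} (h₀ : (z₀ : ℂ) = 1) :
    Tendsto (fun z : s => invCayley z) (𝓝[≠] z₀) (cocompact ℝ) := by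
  rw [← Metric.cobounded_eq_cocompact, ← tendsto_norm_atTop_iff_cobounded]
  have h1 : Tendsto (fun z : s => ‖(1 - (z : ℂ)) / (2 * Complex.I)‖) (𝓝[≠] z₀) (𝓝[>] 0) := by
    refine tendsto_nhdsWithin_iff.mpr ⟨?_, ?_⟩
    · have : Continuous fun z : s => ‖(1 - (z : ℂ)) / (2 * Complex.I)‖ := by fun_prop
      have := this.tendsto z₀
      simp only [h₀, sub_self, zero_div, norm_zero] at this
      exact this.mono_left nhdsWithin_le_nhds
    · refine eventually_nhdsWithin_of_forall fun z hz => ?_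
      have hne : (z : ℂ) ≠ 1 := fun h => hz (Subtype.ext (h.trans h₀.symm))
      simpa [sub_eq_zero] using hne.symm
  have h2 := tendsto_atTop_add_const_right _ (-1 : ℝ) (tendsto_inv_nhdsGT_zero.comp h1)
  refine tendsto_atTop_mono' _ ?_ h2
  refine eventually_nhdsWithin_of_forall fun z hz => ?_
  have hne : (z : ℂ) ≠ 1 := fun h => hz (Subtype.ext (h.trans h₀.symm))
  have hn : ‖(z : ℂ)‖ = 1 := by simpa using hs z.2
  simp only [Function.comp_apply]
  rw [← inv_invCayley_add_I hn hne, norm_inv, inv_inv]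
  have := norm_add_le (invCayley z : ℂ) Complex.I
  rw [Complex.norm_I, Complex.norm_real] at this
  linarith

open Classical in
/-- The pullback of a function on the real line to the unit circle under the inverse Cayley
transform, extended by zero at the point `1`. -/
noncomputable def pullbackFun (φ : C₀(ℝ, ℂ)) (z : ℂ) : ℂ := if z = 1 then 0 else φ (invCayley z)

/-- The point `1` corresponds to infinity on the line, so continuity there is exactly the vanishing
of `φ` at infinity. -/
theorem continuous_pullbackFun {s : Set ℂ} (hs : s ⊆ Metric.sphere 0 1) (φ : C₀(ℝ, ℂ)) :
    Continuous fun z : s => pullbackFun φ z := by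
  refine continuous_iff_continuousAt.mpr fun z₀ => ?_
  by_cases h₀ : (z₀ : ℂ) = 1
  · rw [continuousAt_iff_punctured_nhds, pullbackFun, if_pos h₀]
    refine ((zero_at_infty φ).comp (tendsto_invCayley hs h₀)).congr' ?_
    refine eventually_nhdsWithin_of_forall fun z hz => ?_
    have hne : (z : ℂ) ≠ 1 := fun h => hz (Subtype.ext (h.trans h₀.symm))
    simp [pullbackFun, hne]
  · have hn : ‖(z₀ : ℂ)‖ = 1 := by simpa using hs z₀.2
    have h1 : ContinuousAt (fun z : s => φ (invCayley z)) z₀ := by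
      refine φ.continuous.continuousAt.comp ?_
      unfold invCayley
      refine ContinuousAt.div ?_ ?_ (re_ne_one_of_norm_eq_one hn h₀)
      · exact (Complex.continuous_im.comp continuous_subtype_val).neg.continuousAt
      · exact (continuous_const.sub (Complex.continuous_re.comp continuous_subtype_val)).continuousAt
    refine h1.congr ?_
    have : {z : s | (z : ℂ) ≠ 1} ∈ 𝓝 z₀ :=
      (isOpen_ne.preimage continuous_subtype_val).mem_nhds h₀
    filter_upwards [this] with z hz
    simp [pullbackFun, show (z : ℂ) ≠ 1 from hz]

/-- The pullback of functions on the real line to a subset of the unit circle under the inverse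
Cayley transform, as a `*`-homomorphism. -/
noncomputable def cayleyPullback {s : Set ℂ} (hs : s ⊆ Metric.sphere 0 1) :
    C₀(ℝ, ℂ) →⋆ₙₐ[ℂ] C(s, ℂ) where
  toFun φ := ⟨fun z => pullbackFun φ z, continuous_pullbackFun hs φ⟩
  map_smul' c φ := by ext z; simp [pullbackFun]
  map_zero' := by ext z; simp [pullbackFun]
  map_add' φ ψ := by
    ext z
    by_cases h : (z : ℂ) = 1 <;> simp [pullbackFun, h]
  map_mul' φ ψ := by
    ext z
    by_cases h : (z : ℂ) = 1 <;> simp [pullbackFun, h]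
  map_star' φ := by
    ext z
    by_cases h : (z : ℂ) = 1 <;> simp [pullbackFun, h]

theorem tendsto_ofReal_add_I :
    Tendsto (fun r : ℝ => (r : ℂ) + Complex.I) (cocompact ℝ) (Bornology.cobounded ℂ) := by
  rw [← Metric.cobounded_eq_cocompact, ← tendsto_norm_atTop_iff_cobounded]
  have h1 : Tendsto (fun r : ℝ => ‖r‖ + -1) (Bornology.cobounded ℝ) atTop :=
    tendsto_atTop_add_const_right _ _ tendsto_norm_cobounded_atTop
  refine tendsto_atTop_mono (fun r => ?_) h1
  have := norm_sub_le_norm_add (r : ℂ) Complex.I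
  rw [Complex.norm_I, Complex.norm_real] at this
  linarith

theorem ofReal_add_I_ne_zero (r : ℝ) : (r : ℂ) + Complex.I ≠ 0 := by
  intro h
  have := congrArg Complex.im h
  simp at this

/-- The function `r ↦ (r + i)⁻¹`. -/
noncomputable def invAddI : C₀(ℝ, ℂ) where
  toFun r := ((r : ℂ) + Complex.I)⁻¹
  continuous_toFun := (by fun_prop : Continuous fun r : ℝ => (r : ℂ) + Complex.I).inv₀
    ofReal_add_I_ne_zero
  zero_at_infty' := tendsto_inv₀_cobounded.comp tendsto_ofReal_add_I

theorem invAddI_apply (r : ℝ) : invAddI r = ((r : ℂ) + Complex.I)⁻¹ := rfl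

theorem cayleyPullback_invAddI {s : Set ℂ} (hs : s ⊆ Metric.sphere 0 1) :
    cayleyPullback hs invAddI =
      (2 * Complex.I)⁻¹ • (1 - (ContinuousMap.id ℂ).restrict s) := by
  ext z
  have hn : ‖(z : ℂ)‖ = 1 := by simpa using hs z.2
  change pullbackFun _ _ = (2 * Complex.I)⁻¹ • (1 - (z : ℂ))
  by_cases h : (z : ℂ) = 1
  · simp [pullbackFun, h]
  · rw [pullbackFun, if_neg h, invAddI_apply, inv_invCayley_add_I hn h, smul_eq_mul, div_eq_inv_mul]

end CayleyPullback

/-! ### Existence of the functional calculus. -/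

section Existence

variable {A : Type*} [NonUnitalCStarAlgebra A] [PartialOrder A] [StarOrderedRing A]
variable {H : Type*} [NormedAddCommGroup H] [NormedSpace ℂ H] [SMul A H] [CStarModule A H]
variable [CompleteSpace H]
variable {P : H →ₗ.[ℂ] H} (hP : IsRegular A P) (h : IsSelfAdjoint A P)

theorem isStarNormal_cayley : IsStarNormal (cayley hP h) := by
  have := cayley_mem_unitary hP h
  exact ⟨by rw [Commute, SemiconjBy, (Unitary.mem_iff.mp this).1, (Unitary.mem_iff.mp this).2]⟩

/-- The functional calculus of a regular self-adjoint operator, obtained from the continuous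
functional calculus of its Cayley transform, with values in the adjointable operators. -/
noncomputable def cayleyCalculus : C₀(ℝ, ℂ) →⋆ₙₐ[ℂ] Adjointable A H :=
  ((cfcHom (isStarNormal_cayley hP h) :
    C(spectrum ℂ (cayley hP h), ℂ) →⋆ₐ[ℂ] Adjointable A H) :
    C(spectrum ℂ (cayley hP h), ℂ) →⋆ₙₐ[ℂ] Adjointable A H).comp
    (cayleyPullback (spectrum.subset_circle_of_unitary (cayley_mem_unitary hP h)))

/-- This ties the calculus to `P`: `(r + i)⁻¹` becomes `(1 - z) / 2i` on the circle, which the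
calculus of the Cayley transform sends to the resolvent. -/
theorem cayleyCalculus_invAddI :
    cayleyCalculus hP h invAddI = resolventAdj hP h (.inl rfl) := by
  have h1 : cayleyCalculus hP h invAddI = cfcHom (isStarNormal_cayley hP h)
    (cayleyPullback (spectrum.subset_circle_of_unitary (cayley_mem_unitary hP h)) invAddI) := rfl
  have hI : (2 * Complex.I : ℂ) ≠ 0 := by simp
  have h2 : 1 - cayley hP h = (2 * Complex.I) • resolventAdj hP h (.inl rfl) := by
    rw [cayley, sub_sub_cancel]
  rw [h1, cayleyPullback_invAddI, map_smul, map_sub, map_one, cfcHom_id, h2, smul_smul,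
    inv_mul_cancel₀ hI, one_smul]

/-- The functional calculus of a regular self-adjoint operator, with values in the bounded
operators. -/
noncomputable def cayleyRep : C₀(ℝ, ℂ) →ₙₐ[ℂ] (H →L[ℂ] H) :=
  (Adjointable.toCLM A H : Adjointable A H →ₙₐ[ℂ] (H →L[ℂ] H)).comp
    (cayleyCalculus hP h : C₀(ℝ, ℂ) →ₙₐ[ℂ] Adjointable A H)

theorem cayleyRep_apply (φ : C₀(ℝ, ℂ)) : cayleyRep hP h φ = (cayleyCalculus hP h φ).1 := rfl

theorem cayleyRep_invAddI : cayleyRep hP h invAddI = resolvent hP h (.inl rfl) := by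
  rw [cayleyRep_apply, cayleyCalculus_invAddI]
  rfl

/-- Already the range of `π((r + i)⁻¹) = (P + i)⁻¹` contains `dom P`. -/
theorem dense_span_range_cayleyRep :
    Dense (Submodule.span ℂ {y : H | ∃ (φ : C₀(ℝ, ℂ)) (x : H), cayleyRep hP h φ x = y} : Set H) := by
  refine h.dense_domain.mono fun x hx => ?_
  refine Submodule.subset_span ⟨invAddI, P ⟨x, hx⟩ + Complex.I • x, ?_⟩
  rw [cayleyRep_invAddI]
  exact resolvent_add_smul hP h (.inl rfl) (P.mem_graph ⟨x, hx⟩)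

theorem isNondegenerateRep_cayleyRep : IsNondegenerateRep A (cayleyRep hP h) where
  adjoint φ x y := by
    rw [cayleyRep_apply, cayleyRep_apply, map_star]
    exact Adjointable.isAdjointOf_star _ x y
  nondegenerate := dense_span_range_cayleyRep hP h

/-- If `ψ = r φ` then `φ = (r + i)⁻¹ (ψ + i φ)`, so `π(φ) x` is a value of the resolvent and `P`
maps it to `π(ψ) x`. -/
theorem extensionGraph_cayleyRep_le :
    extensionGraph (cayleyRep hP h) ⟨fun r : ℝ => (r : ℂ), Complex.continuous_ofReal⟩ ≤
      P.graph := by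
  refine Submodule.topologicalClosure_minimal _ (Submodule.span_le.mpr ?_) hP.isClosed
  rintro _ ⟨φ, ψ, x, hφψ, rfl⟩
  have h1 : φ = invAddI * (ψ + Complex.I • φ) := by
    ext r
    have := hφψ r
    simp only [ContinuousMap.coe_mk] at this
    simp only [ZeroAtInftyContinuousMap.mul_apply, ZeroAtInftyContinuousMap.add_apply,
      ZeroAtInftyContinuousMap.smul_apply, smul_eq_mul, this, invAddI_apply]
    rw [← add_mul, inv_mul_cancel_left₀ (ofReal_add_I_ne_zero r)]
  have h2 := resolvent_mem_graph hP h (.inl rfl)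
    (cayleyRep hP h (ψ + Complex.I • φ) x)
  rw [← cayleyRep_invAddI, ← mul_apply_eq_comp, ← map_mul, ← h1] at h2
  simpa using h2

/-- The bounded map `L = (R, 1 - iR)`, `R = (P + i)⁻¹`, parametrizes the graph of `P`. By density it
suffices to treat `L (π(φ) x)`, where `r (r + i)⁻¹ = 1 - i (r + i)⁻¹` applies. -/
theorem graph_le_extensionGraph_cayleyRep :
    P.graph ≤
      extensionGraph (cayleyRep hP h) ⟨fun r : ℝ => (r : ℂ), Complex.continuous_ofReal⟩ := by
  intro p hp
  let L : H →L[ℂ] H × H := (resolvent hP h (.inl rfl)).prod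
    (1 - Complex.I • resolvent hP h (.inl rfl))
  have hL : L (p.2 + Complex.I • p.1) = p := by
    have := resolvent_add_smul hP h (.inl rfl) hp
    ext <;> simp [L, this]
  rw [← hL]
  have hmem : p.2 + Complex.I • p.1 ∈ closure
    (Submodule.span ℂ {y : H | ∃ (φ : C₀(ℝ, ℂ)) (x : H), cayleyRep hP h φ x = y} : Set H) :=
    dense_span_range_cayleyRep hP h _
  refine map_mem_closure L.continuous hmem fun y hy => ?_
  refine Submodule.span_induction (p := fun y _ => L y ∈ _) ?_ (by simp) ?_ ?_ hy
  · rintro _ ⟨φ, x, rfl⟩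
    refine Submodule.subset_span ⟨invAddI * φ, φ - Complex.I • (invAddI * φ), x, fun r => ?_, ?_⟩
    · have := ofReal_add_I_ne_zero r
      simp only [ZeroAtInftyContinuousMap.mul_apply, ZeroAtInftyContinuousMap.sub_apply,
        ZeroAtInftyContinuousMap.smul_apply, smul_eq_mul, invAddI_apply, ContinuousMap.coe_mk]
      field_simp
      ring
    · simp [L, ← cayleyRep_invAddI]
  · intro y z _ _ hy hz
    rw [map_add]
    exact add_mem hy hz
  · intro c y _ hy
    rw [map_smul]
    exact Submodule.smul_mem _ c hy

theorem isFunctionalCalculus_cayleyRep : IsFunctionalCalculus A P (cayleyRep hP h) where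
  rep := isNondegenerateRep_cayleyRep hP h
  extension_id :=
    le_antisymm (extensionGraph_cayleyRep_le hP h) (graph_le_extensionGraph_cayleyRep hP h)

-- From here on only the defining properties of a functional calculus matter, so it is irrelevant
-- which one the choice picks.
include hP h in
theorem isFunctionalCalculus_functionalCalculus :
    IsFunctionalCalculus A P (functionalCalculus A P) := by
  have hex : ∃ π, IsFunctionalCalculus A P π := ⟨_, isFunctionalCalculus_cayleyRep hP h⟩
  rw [functionalCalculus, dif_pos hex]
  exact hex.choose_spec

end Existence

/-! ### Multiplication by `e^{-itr}` on `C₀(ℝ)`. -/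

section ExpMul

open Filter Topology

theorem expFun_apply (t r : ℝ) : expFun t r = Complex.exp (-(Complex.I * t * r)) := rfl

theorem norm_expFun (t r : ℝ) : ‖expFun t r‖ = 1 := by
  simp [expFun_apply, Complex.norm_exp]

theorem star_expFun_mul_self (t r : ℝ) : star (expFun t r) * expFun t r = 1 := by
  rw [mul_comm]
  change expFun t r * (starRingEnd ℂ) (expFun t r) = 1
  rw [Complex.mul_conj, Complex.normSq_eq_norm_sq, norm_expFun]
  simp

theorem expFun_add (s t r : ℝ) : expFun (s + t) r = expFun s r * expFun t r := by
  simp only [expFun_apply, ← Complex.exp_add]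
  push_cast
  ring_nf

theorem expFun_zero (r : ℝ) : expFun 0 r = 1 := by simp [expFun_apply]

theorem norm_expFun_sub_le (s t r : ℝ) : ‖expFun t r - expFun s r‖ ≤ |t - s| * |r| := by
  have h : expFun t r - expFun s r =
      expFun s r * (Complex.exp (Complex.I * ((-((t - s) * r) : ℝ) : ℂ)) - 1) := by
    rw [mul_sub, mul_one, expFun_apply, expFun_apply, ← Complex.exp_add]
    push_cast
    ring_nf
  rw [h, norm_mul, norm_expFun, one_mul, ← abs_mul]
  refine (Real.norm_exp_I_mul_ofReal_sub_one_le).trans ?_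
  rw [Real.norm_eq_abs, abs_neg]

/-- The product `f_t φ` of `f_t(r) = e^{-itr}` and `φ ∈ C₀(ℝ)`. -/
noncomputable def expMul (t : ℝ) (φ : C₀(ℝ, ℂ)) : C₀(ℝ, ℂ) where
  toFun r := expFun t r * φ r
  continuous_toFun := by fun_prop
  zero_at_infty' := by
    refine squeeze_zero_norm (fun r => ?_) (tendsto_zero_iff_norm_tendsto_zero.mp (zero_at_infty φ))
    rw [norm_mul, norm_expFun, one_mul]

theorem expMul_apply (t : ℝ) (φ : C₀(ℝ, ℂ)) (r : ℝ) : expMul t φ r = expFun t r * φ r := rfl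

theorem expMul_zero (φ : C₀(ℝ, ℂ)) : expMul 0 φ = φ := by
  ext r
  rw [expMul_apply, expFun_zero, one_mul]

theorem expMul_expMul (s t : ℝ) (φ : C₀(ℝ, ℂ)) : expMul s (expMul t φ) = expMul (s + t) φ := by
  ext r
  rw [expMul_apply, expMul_apply, expMul_apply, expFun_add, mul_assoc]

/-- Off a compact set `φ` is small and `|f_t - f_{t₀}| ≤ 2`; on it, `|f_t - f_{t₀}| ≤ |t - t₀| |r|`
is uniformly small. -/
theorem continuous_expMul (φ : C₀(ℝ, ℂ)) : Continuous fun t => expMul t φ := by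
  refine continuous_iff_continuousAt.mpr fun t₀ => ?_
  rw [ContinuousAt, ZeroAtInftyContinuousMap.tendsto_iff_tendstoUniformly,
    Metric.tendstoUniformly_iff]
  intro ε hε
  have h1 : ∀ᶠ r in cocompact ℝ, ‖φ r‖ < ε / 2 := by
    have := (tendsto_zero_iff_norm_tendsto_zero.mp (zero_at_infty φ))
    exact this.eventually (gt_mem_nhds (half_pos hε))
  obtain ⟨K, hK, hKφ⟩ := mem_cocompact.mp h1
  obtain ⟨R, hR0, hR⟩ := hK.isBounded.exists_pos_norm_le
  have hc : ContinuousAt (fun t : ℝ => |t - t₀| * R * ‖φ‖) t₀ := by fun_prop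
  have h2 : ∀ᶠ t in 𝓝 t₀, |t - t₀| * R * ‖φ‖ < ε :=
    hc.eventually (gt_mem_nhds (by simpa using hε))
  filter_upwards [h2] with t ht r
  rw [dist_comm, dist_eq_norm, expMul_apply, expMul_apply, ← sub_mul, norm_mul]
  by_cases hr : r ∈ K
  · refine lt_of_le_of_lt ?_ ht
    refine mul_le_mul ((norm_expFun_sub_le t₀ t r).trans ?_) (φ.toBCF.norm_coe_le_norm r)
      (norm_nonneg _) (by positivity)
    gcongr
    exact hR r hr
  · have h3 : ‖expFun t r - expFun t₀ r‖ ≤ 2 := by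
      refine (norm_sub_le _ _).trans ?_
      rw [norm_expFun, norm_expFun]
      norm_num
    have h4 : ‖φ r‖ < ε / 2 := hKφ hr
    nlinarith [norm_nonneg (φ r)]

/-- Evaluation at a point, as a continuous linear form on `C₀(ℝ)`. -/
noncomputable def evalC₀ (r : ℝ) : C₀(ℝ, ℂ) →L[ℂ] ℂ :=
  LinearMap.mkContinuous
    { toFun := fun φ => φ r
      map_add' := fun _ _ => rfl
      map_smul' := fun _ _ => rfl } 1 fun φ => by
    rw [one_mul]
    exact φ.toBCF.norm_coe_le_norm r

theorem evalC₀_apply (r : ℝ) (φ : C₀(ℝ, ℂ)) : evalC₀ r φ = φ r := rfl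

/-- Evaluations separate points and commute with the integral, which reduces this to scalar
calculus. The integrated form passes through the bounded map `φ ↦ π(φ) x`. -/
theorem expMul_sub_self {φ ψ : C₀(ℝ, ℂ)} (hφψ : ∀ r : ℝ, ψ r = r * φ r) (t : ℝ) :
    expMul t φ - φ = -Complex.I • ∫ s in (0 : ℝ)..t, expMul s ψ := by
  ext r
  have hint : IntervalIntegrable (fun s => expMul s ψ) MeasureTheory.volume 0 t :=
    (continuous_expMul ψ).intervalIntegrable _ _
  rw [← evalC₀_apply, ← evalC₀_apply, map_smul,
    ← ContinuousLinearMap.intervalIntegral_comp_comm _ hint,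
    ← intervalIntegral.integral_smul]
  have hd : ∀ s ∈ Set.uIcc 0 t, HasDerivAt (fun s : ℝ => expFun s r * φ r)
      (-Complex.I • evalC₀ r (expMul s ψ)) s := fun s _ => by
    have h1 : HasDerivAt (fun s : ℝ => -(Complex.I * s * r)) (-(Complex.I * 1 * r)) s :=
      (((Complex.ofRealCLM.hasDerivAt (x := s)).const_mul Complex.I).mul_const (r : ℂ)).neg
    refine (h1.cexp.mul_const (φ r)).congr_deriv ?_
    rw [evalC₀_apply, expMul_apply, expFun_apply, hφψ r, smul_eq_mul]
    ring
  rw [intervalIntegral.integral_eq_sub_of_hasDerivAt hd]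
  · simp [evalC₀_apply, expMul_apply, expFun_zero]
  · refine Continuous.intervalIntegrable ?_ _ _
    have hc : Continuous fun s => evalC₀ r (expMul s ψ) :=
      (evalC₀ r).continuous.comp (continuous_expMul ψ)
    exact hc.const_smul (-Complex.I)

end ExpMul

/-! ### The isometries `e^{-itP}` attached to a representation. -/

section UnitaryGroup

open Filter Topology

variable {A : Type*} [NonUnitalCStarAlgebra A] [PartialOrder A] [StarOrderedRing A]
variable {H : Type*} [NormedAddCommGroup H] [NormedSpace ℂ H] [SMul A H] [CStarModule A H]
variable {π : C₀(ℝ, ℂ) →ₙₐ[ℂ] (H →L[ℂ] H)}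

/-- A nondegenerate representation of `C₀(ℝ)`, as a `*`-homomorphism to the adjointable
operators. -/
noncomputable def IsNondegenerateRep.toAdjointable [CompleteSpace H] (hπ : IsNondegenerateRep A π) :
    C₀(ℝ, ℂ) →⋆ₙₐ[ℂ] Adjointable A H where
  toFun φ := ⟨π φ, π (star φ), hπ.adjoint φ⟩
  map_smul' c φ := Subtype.ext (map_smul π c φ)
  map_zero' := Subtype.ext (map_zero π)
  map_add' φ ψ := Subtype.ext (map_add π φ ψ)
  map_mul' φ ψ := Subtype.ext (map_mul π φ ψ)
  map_star' φ := by
    refine (Adjointable.star_eq_of_isAdjointOf ?_).symm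
    exact (show IsAdjointOf A (π (star φ)) (π φ) from hπ.adjoint φ)

theorem IsNondegenerateRep.norm_le [CompleteSpace H] (hπ : IsNondegenerateRep A π)
    (φ : C₀(ℝ, ℂ)) : ‖π φ‖ ≤ ‖φ‖ :=
  NonUnitalStarAlgHom.norm_apply_le hπ.toAdjointable φ

/-- The map `φ ↦ π(φ) x`. -/
noncomputable def IsNondegenerateRep.evalVec [CompleteSpace H] (hπ : IsNondegenerateRep A π)
    (x : H) : C₀(ℝ, ℂ) →L[ℂ] H :=
  LinearMap.mkContinuous
    { toFun := fun φ => π φ x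
      map_add' := fun φ ψ => by simp
      map_smul' := fun c φ => by simp } ‖x‖ fun φ => by
    rw [mul_comm]
    exact (π φ).le_of_opNorm_le (hπ.norm_le φ) x

theorem IsNondegenerateRep.evalVec_apply [CompleteSpace H] (hπ : IsNondegenerateRep A π)
    (x : H) (φ : C₀(ℝ, ℂ)) : hπ.evalVec x φ = π φ x := rfl

theorem IsNondegenerateRep.inner_apply_apply (hπ : IsNondegenerateRep A π) (φ ψ : C₀(ℝ, ℂ))
    (x y : H) : (inner A (π φ x) (π ψ y) : A) = inner A x (π (star φ * ψ) y) := by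
  rw [hπ.adjoint, map_mul, mul_apply_eq_comp]

/-- Since `f̄_t f_t = 1`, inner products of first and of second components agree on the span;
equality of norms survives the closure. -/
theorem IsNondegenerateRep.norm_fst_eq_norm_snd (hπ : IsNondegenerateRep A π) {t : ℝ} {p : H × H}
    (hp : p ∈ extensionGraph π (expFun t)) : ‖p.1‖ = ‖p.2‖ := by
  have hclosed : IsClosed {p : H × H | ‖p.1‖ = ‖p.2‖} :=
    isClosed_eq (by fun_prop) (by fun_prop)
  refine closure_minimal (fun q hq => ?_) hclosed hp
  -- The identity is needed for two independent vectors, since its diagonal case is not additive.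
  have key : ∀ p ∈ Submodule.span ℂ {p : H × H | ∃ (φ ψ : C₀(ℝ, ℂ)) (x : H),
      (∀ r : ℝ, ψ r = expFun t r * φ r) ∧ p = (π φ x, π ψ x)},
      ∀ q ∈ Submodule.span ℂ {p : H × H | ∃ (φ ψ : C₀(ℝ, ℂ)) (x : H),
      (∀ r : ℝ, ψ r = expFun t r * φ r) ∧ p = (π φ x, π ψ x)},
      (inner A p.1 q.1 : A) = inner A p.2 q.2 := by
    intro p hp q hq
    induction hp, hq using Submodule.span_induction₂ with
    | mem_mem p q hp hq =>
      obtain ⟨φ, ψ, x, h, rfl⟩ := hp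
      obtain ⟨φ', ψ', x', h', rfl⟩ := hq
      rw [hπ.inner_apply_apply, hπ.inner_apply_apply]
      have : star φ * φ' = star ψ * ψ' := by
        ext r
        simp only [ZeroAtInftyContinuousMap.mul_apply, ZeroAtInftyContinuousMap.star_apply, h, h',
          star_mul']
        linear_combination -(star (φ r) * φ' r) * star_expFun_mul_self t r
      rw [this]
    | zero_left => simp
    | zero_right => simp
    | add_left x y z _ _ _ h₁ h₂ => simp [h₁, h₂]
    | add_right x y z _ _ _ h₁ h₂ => simp [h₁, h₂]
    | smul_left c x y _ _ h => simp [h]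
    | smul_right c x y _ _ h => simp [h]
  change ‖q.1‖ = ‖q.2‖
  rw [CStarModule.norm_eq_sqrt_norm_inner_self (A := A) q.1,
    CStarModule.norm_eq_sqrt_norm_inner_self (A := A) q.2, key q hq q hq]

theorem mem_extensionGraph_expFun (t : ℝ) (φ : C₀(ℝ, ℂ)) (x : H) :
    (π φ x, π (expMul t φ) x) ∈ extensionGraph π (expFun t) :=
  Submodule.le_topologicalClosure _
    (Submodule.subset_span ⟨φ, expMul t φ, x, fun _ => rfl, rfl⟩)

variable [CompleteSpace H]

/-- The first projection of the graph is bounded below, hence has closed range, and this range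
contains the dense span of the `π(φ) x`. -/
theorem IsNondegenerateRep.exists_mem_extensionGraph (hπ : IsNondegenerateRep A π) (t : ℝ)
    (x : H) : ∃ y, (x, y) ∈ extensionGraph π (expFun t) := by
  let G := extensionGraph π (expFun t)
  let F : G →L[ℂ] H := ContinuousLinearMap.fst ℂ H H ∘L G.subtypeL
  have : CompleteSpace G := (Submodule.isClosed_topologicalClosure _).completeSpace_coe
  have hF : AntilipschitzWith 1 F := AddMonoidHomClass.antilipschitz_of_bound _ fun p => by
    rw [NNReal.coe_one, one_mul]
    exact max_le le_rfl (hπ.norm_fst_eq_norm_snd p.2).ge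
  have hcl := hF.isClosed_range F.uniformContinuous
  have hd : Dense (Set.range F) := by
    have h1 : Set.range F = ((F : G →ₗ[ℂ] H).range : Set H) := rfl
    refine hπ.nondegenerate.mono ?_
    rw [h1]
    refine Submodule.span_le.mpr ?_
    rintro _ ⟨φ, x, rfl⟩
    exact ⟨⟨_, mem_extensionGraph_expFun t φ x⟩, rfl⟩
  have hx : x ∈ Set.range F := by rw [← hcl.closure_eq]; exact hd x
  obtain ⟨p, rfl⟩ := hx
  exact ⟨_, p.2⟩

theorem IsNondegenerateRep.eq_of_mem_extensionGraph (hπ : IsNondegenerateRep A π) {t : ℝ}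
    {x y z : H} (hy : (x, y) ∈ extensionGraph π (expFun t))
    (hz : (x, z) ∈ extensionGraph π (expFun t)) : y = z := by
  have := hπ.norm_fst_eq_norm_snd (sub_mem hy hz)
  simp only [Prod.fst_sub, sub_self, norm_zero, Prod.snd_sub] at this
  exact sub_eq_zero.mp (norm_eq_zero.mp this.symm)

/-- The isometry `π̃(f_t)`, for `f_t(r) = e^{-itr}`. -/
noncomputable def IsNondegenerateRep.expIsometry (hπ : IsNondegenerateRep A π) (t : ℝ) :
    H →ₗᵢ[ℂ] H where
  toFun x := (hπ.exists_mem_extensionGraph t x).choose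
  map_add' x y := hπ.eq_of_mem_extensionGraph (hπ.exists_mem_extensionGraph t (x + y)).choose_spec
    (add_mem (hπ.exists_mem_extensionGraph t x).choose_spec
      (hπ.exists_mem_extensionGraph t y).choose_spec)
  map_smul' c x := hπ.eq_of_mem_extensionGraph
    (hπ.exists_mem_extensionGraph t (c • x)).choose_spec
    (Submodule.smul_mem _ c (hπ.exists_mem_extensionGraph t x).choose_spec)
  norm_map' x := (hπ.norm_fst_eq_norm_snd (hπ.exists_mem_extensionGraph t x).choose_spec).symm

variable (hπ : IsNondegenerateRep A π)
include hπ

theorem IsNondegenerateRep.expIsometry_mem (t : ℝ) (x : H) :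
    (x, hπ.expIsometry t x) ∈ extensionGraph π (expFun t) :=
  (hπ.exists_mem_extensionGraph t x).choose_spec

theorem IsNondegenerateRep.expIsometry_apply (t : ℝ) (φ : C₀(ℝ, ℂ)) (x : H) :
    hπ.expIsometry t (π φ x) = π (expMul t φ) x :=
  hπ.eq_of_mem_extensionGraph (hπ.expIsometry_mem t _) (mem_extensionGraph_expFun t φ x)

theorem IsNondegenerateRep.expIsometry_zero (x : H) : hπ.expIsometry 0 x = x := by
  have : (hπ.expIsometry 0).toContinuousLinearMap = ContinuousLinearMap.id ℂ H := by
    refine ContinuousLinearMap.ext_on hπ.nondegenerate ?_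
    rintro _ ⟨φ, x, rfl⟩
    simp [hπ.expIsometry_apply, expMul_zero]
  exact congrArg (fun T : H →L[ℂ] H => T x) this

theorem IsNondegenerateRep.expIsometry_add (s t : ℝ) (x : H) :
    hπ.expIsometry (s + t) x = hπ.expIsometry s (hπ.expIsometry t x) := by
  have : (hπ.expIsometry (s + t)).toContinuousLinearMap =
      (hπ.expIsometry s).toContinuousLinearMap ∘L (hπ.expIsometry t).toContinuousLinearMap := by
    refine ContinuousLinearMap.ext_on hπ.nondegenerate ?_
    rintro _ ⟨φ, x, rfl⟩
    simp [hπ.expIsometry_apply, expMul_expMul]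
  exact congrArg (fun T : H →L[ℂ] H => T x) this

/-- Isometries make orbits of nearby vectors uniformly close, so continuity need only be checked on
the dense span. -/
theorem IsNondegenerateRep.continuous_expIsometry_apply (x : H) :
    Continuous fun t => hπ.expIsometry t x := by
  refine continuous_of_uniform_approx_of_continuous fun u hu => ?_
  obtain ⟨ε, hε, hεu⟩ := Metric.mem_uniformity_dist.mp hu
  obtain ⟨y, hy, hxy⟩ := Metric.mem_closure_iff.mp (hπ.nondegenerate x) ε hε
  refine ⟨fun t => hπ.expIsometry t y, ?_, fun t => hεu ?_⟩
  · refine Submodule.span_induction (p := fun y _ => Continuous fun t => hπ.expIsometry t y)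
      ?_ (by simpa using continuous_const) ?_ ?_ hy
    · rintro _ ⟨φ, x, rfl⟩
      simp only [hπ.expIsometry_apply]
      exact (hπ.evalVec x).continuous.comp (continuous_expMul φ)
    · intro y z _ _ h₁ h₂
      simp only [map_add]
      exact h₁.add h₂
    · intro c y _ h
      simp only [map_smul]
      exact h.const_smul c
  · rwa [(hπ.expIsometry t).isometry.dist_eq]

omit hπ in
theorem expNegI_eq_of_isNondegenerateRep {P : H →ₗ.[ℂ] H}
    (hπ : IsNondegenerateRep A (functionalCalculus A P)) (t : ℝ) (x : H) :
    expNegI A P t x = hπ.expIsometry t x := by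
  have hg : ∀ p ∈ extensionGraph (functionalCalculus A P) (expFun t), p.1 = 0 → p.2 = 0 := by
    intro p hp h0
    rw [← norm_eq_zero, ← hπ.norm_fst_eq_norm_snd hp, h0, norm_zero]
  have hgraph : (expOp A P t).graph = extensionGraph (functionalCalculus A P) (expFun t) :=
    Submodule.toLinearPMap_graph_eq _ hg
  have hmem := hπ.expIsometry_mem t x
  rw [← hgraph] at hmem
  obtain ⟨y, hy1, hy2⟩ := (LinearPMap.mem_graph_iff _).mp hmem
  simp only at hy1 hy2
  have hx : x ∈ (expOp A P t).domain := hy1 ▸ y.2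
  rw [expNegI, dif_pos hx, ← hy2]
  congr 1
  exact Subtype.ext hy1.symm

end UnitaryGroup

/-! ### Strongly continuous families of isometries. -/

/-- A strongly continuous group of isometries `U_t` on `H`, commuting with `P` and with
`d/dt U_t x = - i U_t P x` for `x ∈ dom P`. -/
structure IsUnitaryGroupOf {H : Type*} [NormedAddCommGroup H] [NormedSpace ℂ H]
    (P : H →ₗ.[ℂ] H) (U : ℝ → H →ₗᵢ[ℂ] H) : Prop where
  zero : ∀ x, U 0 x = x
  add : ∀ s t x, U (s + t) x = U s (U t x)
  continuous : ∀ x, Continuous fun t => U t x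
  mem_graph : ∀ t, ∀ p ∈ P.graph, (U t p.1, U t p.2) ∈ P.graph
  hasDerivAt : ∀ p ∈ P.graph, ∀ t, HasDerivAt (fun t => U t p.1) (-(Complex.I • U t p.2)) t

theorem continuous_isometry_uncurry {H : Type*} [NormedAddCommGroup H] [NormedSpace ℂ H]
    {U : ℝ → H →ₗᵢ[ℂ] H} (hU : ∀ x, Continuous fun t => U t x) :
    Continuous fun p : ℝ × H => U p.1 p.2 := by
  refine continuous_iff_continuousAt.mpr fun ⟨t₀, x₀⟩ => ?_
  rw [ContinuousAt, tendsto_iff_norm_sub_tendsto_zero]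
  have h1 : Filter.Tendsto (fun p : ℝ × H => ‖p.2 - x₀‖ + ‖U p.1 x₀ - U t₀ x₀‖)
      (nhds (t₀, x₀)) (nhds 0) := by
    have hc : Continuous fun p : ℝ × H => ‖p.2 - x₀‖ + ‖U p.1 x₀ - U t₀ x₀‖ :=
      (continuous_snd.sub continuous_const).norm.add
        (((hU x₀).comp continuous_fst).sub continuous_const).norm
    simpa using hc.tendsto (t₀, x₀)
  refine squeeze_zero (fun _ => norm_nonneg _) (fun p => ?_) h1
  have : U p.1 p.2 - U t₀ x₀ = U p.1 (p.2 - x₀) + (U p.1 x₀ - U t₀ x₀) := by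
    rw [map_sub]; abel
  rw [this]
  refine (norm_add_le _ _).trans_eq ?_
  rw [LinearIsometry.norm_map]

theorem continuous_integral_isometry {H : Type*} [NormedAddCommGroup H] [NormedSpace ℂ H]
    {U : ℝ → H →ₗᵢ[ℂ] H} (hU : ∀ x, Continuous fun t => U t x) (t : ℝ) :
    Continuous fun x : H => ∫ s in (0 : ℝ)..t, U s x := by
  have h : Continuous (Function.uncurry fun (x : H) (s : ℝ) => U s x) :=
    (continuous_isometry_uncurry hU).comp continuous_swap
  exact intervalIntegral.continuous_parametric_intervalIntegral_of_continuous' h 0 t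

/-! ### `-iP` differentiates the group. -/

section Generator

variable {A : Type*} [NonUnitalCStarAlgebra A] [PartialOrder A] [StarOrderedRing A]
variable {H : Type*} [NormedAddCommGroup H] [NormedSpace ℂ H] [SMul A H] [CStarModule A H]
variable {π : C₀(ℝ, ℂ) →ₙₐ[ℂ] (H →L[ℂ] H)} {P : H →ₗ.[ℂ] H} [CompleteSpace H]

/-- The graph of `P` is the closed span of the pairs `(π(φ) x, π(r φ) x)`, so closed linear
relations can be checked on these. -/
theorem IsFunctionalCalculus.graph_induction (h : IsFunctionalCalculus A P π)
    {G : Submodule ℂ (H × H)} (hG : IsClosed (G : Set (H × H)))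
    (hmem : ∀ (φ ψ : C₀(ℝ, ℂ)) (x : H), (∀ r : ℝ, ψ r = r * φ r) → (π φ x, π ψ x) ∈ G) :
    P.graph ≤ G := by
  rw [← h.extension_id]
  refine Submodule.topologicalClosure_minimal _ (Submodule.span_le.mpr ?_) hG
  rintro _ ⟨φ, ψ, x, hφψ, rfl⟩
  exact hmem φ ψ x hφψ

variable (h : IsFunctionalCalculus A P π)
include h

theorem IsFunctionalCalculus.expIsometry_mem_graph (t : ℝ) {p : H × H} (hp : p ∈ P.graph) :
    (h.rep.expIsometry t p.1, h.rep.expIsometry t p.2) ∈ P.graph := by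
  let L : H × H →L[ℂ] H × H := (h.rep.expIsometry t).toContinuousLinearMap.prodMap
    (h.rep.expIsometry t).toContinuousLinearMap
  have hcl : IsClosed (P.graph : Set (H × H)) := by
    rw [← h.extension_id]
    exact Submodule.isClosed_topologicalClosure _
  refine h.graph_induction (G := P.graph.comap (L : H × H →ₗ[ℂ] H × H))
    (hcl.preimage L.continuous) (fun φ ψ x hφψ => ?_) hp
  change (h.rep.expIsometry t (π φ x), h.rep.expIsometry t (π ψ x)) ∈ P.graph
  rw [h.rep.expIsometry_apply, h.rep.expIsometry_apply, ← h.extension_id]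
  refine Submodule.le_topologicalClosure _ (Submodule.subset_span ⟨_, _, x, fun r => ?_, rfl⟩)
  change expFun t r * ψ r = (r : ℂ) * (expFun t r * φ r)
  rw [hφψ]
  ring

/-- The integrated equation is a closed linear condition on `(x, P x)`, which the derivative is not
visibly; differentiability is recovered afterwards from the fundamental theorem of calculus. -/
theorem IsFunctionalCalculus.expIsometry_sub_self {p : H × H} (hp : p ∈ P.graph) (t : ℝ) :
    h.rep.expIsometry t p.1 - p.1 =
      -Complex.I • ∫ s in (0 : ℝ)..t, h.rep.expIsometry s p.2 := by
  have hint (y : H) : IntervalIntegrable (fun s => h.rep.expIsometry s y)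
      MeasureTheory.volume 0 t :=
    (h.rep.continuous_expIsometry_apply y).intervalIntegrable _ _
  have h1 := (continuous_integral_isometry h.rep.continuous_expIsometry_apply t).comp
    (continuous_snd (X := H))
  let L : H × H →ₗ[ℂ] H :=
    { toFun := fun p => h.rep.expIsometry t p.1 - p.1 +
        Complex.I • ∫ s in (0 : ℝ)..t, h.rep.expIsometry s p.2
      map_add' := fun p q => by
        simp only [Prod.fst_add, Prod.snd_add, map_add]
        rw [intervalIntegral.integral_add (hint _) (hint _)]
        module
      map_smul' := fun c p => by
        simp only [Prod.smul_fst, Prod.smul_snd, map_smul, RingHom.id_apply]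
        rw [intervalIntegral.integral_smul]
        module }
  have hL : Continuous L := by
    exact (((h.rep.expIsometry t).continuous.comp continuous_fst).sub continuous_fst).add
      (h1.const_smul _)
  have hmem : P.graph ≤ LinearMap.ker L := by
    refine h.graph_induction ?_ fun φ ψ x hφψ => ?_
    · exact isClosed_singleton.preimage hL
    · change h.rep.expIsometry t (π φ x) - π φ x +
        Complex.I • ∫ s in (0 : ℝ)..t, h.rep.expIsometry s (π ψ x) = 0
      have h2 := congrArg (h.rep.evalVec x) (expMul_sub_self hφψ t)
      rw [map_sub, map_smul, ← ContinuousLinearMap.intervalIntegral_comp_comm _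
        ((continuous_expMul ψ).intervalIntegrable _ _)] at h2
      simp only [h.rep.evalVec_apply, ← h.rep.expIsometry_apply] at h2
      rw [h2, neg_smul, neg_add_cancel]
  have h3 : L p = 0 := hmem hp
  rw [neg_smul]
  exact eq_neg_of_add_eq_zero_left h3

theorem IsFunctionalCalculus.isUnitaryGroupOf : IsUnitaryGroupOf P h.rep.expIsometry where
  zero := h.rep.expIsometry_zero
  add := h.rep.expIsometry_add
  continuous := h.rep.continuous_expIsometry_apply
  mem_graph t _ hp := h.expIsometry_mem_graph t hp
  hasDerivAt p hp t := by
    have h1 : (fun t => h.rep.expIsometry t p.1) =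
        fun t => p.1 + -Complex.I • ∫ s in (0 : ℝ)..t, h.rep.expIsometry s p.2 := by
      ext t
      rw [← h.expIsometry_sub_self hp, add_sub_cancel]
    rw [h1, ← neg_smul]
    have h2 := (h.rep.continuous_expIsometry_apply p.2).integral_hasStrictDerivAt 0 t
    exact (h2.hasDerivAt.const_smul (-Complex.I)).const_add p.1

end Generator

/-! ### Domains of powers as towers in the graph. -/

section Powers

variable {H : Type*} [AddCommGroup H] [Module ℂ H] {P : H →ₗ.[ℂ] H}

theorem mem_graph_ppow_zero (x : H) : (x, x) ∈ (ppow P 0).graph :=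
  (LinearPMap.mem_graph_iff _).mpr ⟨⟨x, Submodule.mem_top⟩, rfl, rfl⟩

theorem mem_graph_ppow_succ {k : ℕ} {x y z : H} (hxy : (x, y) ∈ (ppow P k).graph)
    (hyz : (y, z) ∈ P.graph) : (x, z) ∈ (ppow P (k + 1)).graph := by
  obtain ⟨x', hx1, hx2⟩ := (LinearPMap.mem_graph_iff _).mp hxy
  obtain ⟨y', hy1, hy2⟩ := (LinearPMap.mem_graph_iff _).mp hyz
  simp only at hx1 hx2 hy1 hy2
  subst hx1
  have hmem : ppow P k x' ∈ P.domain := by rw [hx2, ← hy1]; exact y'.2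
  refine (LinearPMap.mem_graph_iff _).mpr ⟨⟨x', x', hmem, rfl⟩, rfl, ?_⟩
  change P ⟨ppow P k x', hmem⟩ = z
  rw [← hy2]
  congr 1
  exact Subtype.ext (hx2.trans hy1.symm)

theorem ppow_apply_mem_graph {k : ℕ} {x : H} (hx : x ∈ (ppow P k).domain)
    (hx' : x ∈ (ppow P (k + 1)).domain) :
    (ppow P k ⟨x, hx⟩, ppow P (k + 1) ⟨x, hx'⟩) ∈ P.graph := by
  obtain ⟨y, hy, hyx⟩ := hx'
  have hmem : ppow P k ⟨x, hx⟩ ∈ P.domain := by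
    have : y = ⟨x, hx⟩ := Subtype.ext hyx
    rw [← this]
    exact hy
  exact P.mem_graph ⟨_, hmem⟩

/-- A tower `w 0, …, w k` of consecutive graph points encodes `w l = P^l (w 0)` without dependent
domain proofs. -/
theorem mem_graph_ppow_of_tower {k : ℕ} {w : ℕ → H} (hw : ∀ l < k, (w l, w (l + 1)) ∈ P.graph) :
    ∀ l ≤ k, (w 0, w l) ∈ (ppow P l).graph
  | 0, _ => mem_graph_ppow_zero _
  | l + 1, hl => mem_graph_ppow_succ (mem_graph_ppow_of_tower hw l (by omega)) (hw l (by omega))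

theorem exists_tower_of_mem_domain {k : ℕ} {x : H} (hx : x ∈ (ppow P k).domain) :
    ∃ w : ℕ → H, w 0 = x ∧ ∀ l < k, (w l, w (l + 1)) ∈ P.graph := by
  classical
  -- The default `0` beyond `k` is never seen by the graph conditions.
  refine ⟨fun l => if h : l ≤ k then ppow P l ⟨x, ppow_domain_antitone P h hx⟩ else 0, ?_, ?_⟩
  · exact dif_pos (Nat.zero_le k)
  · intro l hl
    beta_reduce
    rw [dif_pos hl.le, dif_pos (Nat.succ_le_of_lt hl)]
    exact ppow_apply_mem_graph _ _

end Powers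

/-! ### Differentiability in Sobolev modules, read off from the powers of `P`. -/

section Sobolev

variable {A : Type*} [NonUnitalCStarAlgebra A] [PartialOrder A] [StarOrderedRing A]
variable {H : Type*} [NormedAddCommGroup H] [NormedSpace ℂ H] [SMul A H] [CStarModule A H]
variable {P : H →ₗ.[ℂ] H} {k : ℕ}

namespace SobolevModule

theorem powMap_mem_graph (u : SobolevModule A P k) {l : ℕ} (hl : l < k) :
    (powMap (⟨l, by omega⟩ : Fin (k + 1)) u, powMap (⟨l + 1, by omega⟩ : Fin (k + 1)) u) ∈
      P.graph :=
  ppow_apply_mem_graph (ppow_domain_antitone P hl.le u.2)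
    (ppow_domain_antitone P (Nat.succ_le_of_lt hl) u.2)

variable (A) in
theorem exists_powMap_eq {w : ℕ → H} (hw : ∀ l < k, (w l, w (l + 1)) ∈ P.graph) :
    ∃ u : SobolevModule A P k, ∀ l : Fin (k + 1), powMap l u = w l := by
  have hgr := mem_graph_ppow_of_tower hw
  obtain ⟨x, hx, -⟩ := (LinearPMap.mem_graph_iff _).mp (hgr k le_rfl)
  simp only at hx
  refine ⟨⟨w 0, hx ▸ x.2⟩, fun l => ?_⟩
  obtain ⟨y, hy, hy'⟩ := (LinearPMap.mem_graph_iff _).mp (hgr l (Nat.lt_succ_iff.mp l.2))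
  simp only at hy hy'
  rw [← hy']
  change ppow P l ⟨w 0, _⟩ = ppow P l y
  congr 1
  exact Subtype.ext hy.symm

theorem embed_apply (u : SobolevModule A P k) (l : Fin (k + 1)) :
    embed u l = ((√(k.choose l : ℝ) : ℝ) : ℂ) • powMap l u := rfl

theorem norm_embed (u : SobolevModule A P k) : ‖embed u‖ = ‖u‖ := rfl

theorem norm_powMap_le (u : SobolevModule A P k) (l : Fin (k + 1)) : ‖powMap l u‖ ≤ ‖u‖ := by
  rw [← norm_embed]
  refine le_trans ?_ (WithCStarModule.norm_apply_le_norm (embed u) l)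
  rw [embed_apply, norm_smul, Complex.norm_real, Real.norm_of_nonneg (Real.sqrt_nonneg _)]
  refine le_mul_of_one_le_left (norm_nonneg _) ?_
  rw [Real.one_le_sqrt]
  exact_mod_cast Nat.choose_pos (Nat.lt_succ_iff.mp l.2)

/-- With `norm_powMap_le`, this makes convergence in `H^k` the same as convergence of every `P^l u`,
`l ≤ k`, in `H`. -/
theorem norm_le_sum (u : SobolevModule A P k) :
    ‖u‖ ≤ ∑ l : Fin (k + 1), ‖(√(k.choose l : ℝ)) • powMap l u‖ := by
  rw [← norm_embed]
  refine (WithCStarModule.pi_norm_le_sum_norm _).trans_eq (Finset.sum_congr rfl fun l _ => ?_)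
  rw [embed_apply, norm_smul, norm_smul, Complex.norm_real]

/-- The operator `P^l : H^k → H` as a bounded operator. -/
noncomputable def powMapL (l : Fin (k + 1)) : SobolevModule A P k →L[ℂ] H :=
  (powMap l).mkContinuous 1 fun u => by rw [one_mul]; exact norm_powMap_le u l

theorem continuous_of_powMap {v : ℝ → SobolevModule A P k}
    (h : ∀ l, Continuous fun t => powMap l (v t)) : Continuous v := by
  refine continuous_iff_continuousAt.mpr fun t₀ => ?_
  rw [ContinuousAt, tendsto_iff_norm_sub_tendsto_zero]
  refine squeeze_zero (fun _ => norm_nonneg _) (fun t => norm_le_sum _) ?_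
  have h1 : Continuous fun t =>
      ∑ l : Fin (k + 1), ‖(√(k.choose l : ℝ)) • powMap l (v t - v t₀)‖ := by
    simp only [map_sub]
    exact continuous_finsetSum _ fun l _ => (((h l).sub continuous_const).const_smul _).norm
  simpa using h1.tendsto t₀

theorem hasDerivAt_of_powMap {v : ℝ → SobolevModule A P k} {v' : SobolevModule A P k} {t : ℝ}
    (h : ∀ l, HasDerivAt (fun t => powMap l (v t)) (powMap l v') t) : HasDerivAt v v' t := by
  rw [hasDerivAt_iff_isLittleO]
  have h1 : (fun s => v s - v t - (s - t) • v') =O[nhds t] fun s =>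
      ∑ l : Fin (k + 1), ‖(√(k.choose l : ℝ)) • powMap l (v s - v t - (s - t) • v')‖ := by
    refine Asymptotics.IsBigO.of_bound 1 (Filter.Eventually.of_forall fun s => ?_)
    rw [one_mul]
    exact (norm_le_sum _).trans (le_abs_self _)
  refine h1.trans_isLittleO (Asymptotics.IsLittleO.fun_sum fun l _ => ?_)
  refine Asymptotics.IsLittleO.norm_left (Asymptotics.IsLittleO.const_smul_left ?_ _)
  have h2 := (hasDerivAt_iff_isLittleO.mp (h l))
  refine h2.congr_left fun s => ?_
  rw [map_sub, map_sub, LinearMap.map_smul_of_tower]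

end SobolevModule

/-- Difference quotients stay in the subspace, and so does their limit. Applied to the graph of `P`,
it says that `P` commutes with `d/dt`. -/
theorem deriv_mem_of_isClosed {E : Type*} [NormedAddCommGroup E] [NormedSpace ℂ E]
    {G : Submodule ℂ E} (hG : IsClosed (G : Set E)) {p : ℝ → E} (hp : ∀ t, p t ∈ G) (t : ℝ) :
    deriv p t ∈ G := by
  have h1 := range_deriv_subset_closure_span_image p (t := Set.univ) dense_univ ⟨t, rfl⟩
  refine closure_minimal ?_ hG h1
  change (Submodule.span ℝ (p '' Set.univ) : Set E) ⊆ (G.restrictScalars ℝ : Set E)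
  refine SetLike.coe_subset_coe.mpr (Submodule.span_le.mpr ?_)
  rintro _ ⟨s, -, rfl⟩
  exact hp s

/-- As the graph is closed, the derivatives of the `P^l v` again form a tower, hence a function with
values in `H^k`; this is the derivative of `v`, and induction applies to it. -/
theorem SobolevModule.contDiff_of_powMap (hP : P.IsClosed) : ∀ (j : ℕ)
    {v : ℝ → SobolevModule A P k} (_ : ∀ l, ContDiff ℝ j fun t => powMap l (v t)), ContDiff ℝ j v
  | 0, v, h => by
    rw [Nat.cast_zero, contDiff_zero]
    exact continuous_of_powMap fun l => (h l).continuous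
  | j + 1, v, h => by
    have hd (l : Fin (k + 1)) (t : ℝ) : HasDerivAt (fun t => powMap l (v t))
        (deriv (fun t => powMap l (v t)) t) t :=
      (((h l).differentiable (by simp)) t).hasDerivAt
    have hex (t : ℝ) : ∃ v' : SobolevModule A P k,
        ∀ l : Fin (k + 1), powMap l v' = deriv (fun t => powMap l (v t)) t := by
      obtain ⟨v', hv'⟩ := exists_powMap_eq A (P := P) (k := k)
        (w := fun l => if hl : l < k + 1 then
          deriv (fun t => powMap (⟨l, hl⟩ : Fin (k + 1)) (v t)) t else 0) (fun l hl => by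
        rw [dif_pos (by omega), dif_pos (by omega)]
        have h1 := deriv_mem_of_isClosed hP (fun t => powMap_mem_graph (v t) hl) t
        rwa [((hd ⟨l, by omega⟩ t).prodMk (hd ⟨l + 1, by omega⟩ t)).deriv] at h1)
      exact ⟨v', fun l => by rw [hv', dif_pos l.2]⟩
    choose v' hv' using hex
    have hv (t : ℝ) : HasDerivAt v (v' t) t := hasDerivAt_of_powMap fun l => by
      rw [hv' t l]
      exact hd l t
    push_cast
    rw [contDiff_succ_iff_deriv]
    refine ⟨fun t => (hv t).differentiableAt, by simp, ?_⟩
    rw [show deriv v = v' from funext fun t => (hv t).deriv]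
    refine contDiff_of_powMap hP j fun l => ?_
    simp only [hv']
    have h2 := h l
    push_cast at h2
    exact (contDiff_succ_iff_deriv.mp h2).2.2

theorem MemC.exists_tower {j m : ℕ} {u : ℝ → H} (h : MemC A P j m u) :
    ∃ w : ℕ → ℝ → H, w 0 = u ∧ (∀ l < m, ∀ t, (w l t, w (l + 1) t) ∈ P.graph) ∧
      ∀ l ≤ m, ContDiff ℝ j (w l) := by
  obtain ⟨v, hv, hvu⟩ := h
  refine ⟨fun l t => if hl : l < m + 1 then
    SobolevModule.powMap (⟨l, hl⟩ : Fin (m + 1)) (v t) else 0, ?_, ?_, ?_⟩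
  · ext t
    rw [← hvu]
    exact dif_pos (Nat.succ_pos m)
  · intro l hl t
    beta_reduce
    rw [dif_pos (by omega), dif_pos (by omega)]
    exact SobolevModule.powMap_mem_graph (v t) hl
  · intro l hl
    simp only [dif_pos (Nat.lt_succ_of_le hl)]
    exact ((SobolevModule.powMapL _).restrictScalars ℝ).contDiff.comp hv

theorem memC_of_tower (hP : P.IsClosed) {j m : ℕ} {w : ℕ → ℝ → H}
    (hw : ∀ l < m, ∀ t, (w l t, w (l + 1) t) ∈ P.graph) (hc : ∀ l ≤ m, ContDiff ℝ j (w l)) :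
    MemC A P j m (w 0) := by
  have hex (t : ℝ) := SobolevModule.exists_powMap_eq A (w := fun l => w l t) fun l hl => hw l hl t
  choose v hv using hex
  refine ⟨v, SobolevModule.contDiff_of_powMap hP j fun l => ?_, fun t => hv t 0⟩
  simp only [hv]
  exact hc l (Nat.lt_succ_iff.mp l.2)

end Sobolev

/-! ### Duhamel's formula. -/

section Cauchy

variable {H : Type*} [NormedAddCommGroup H] [NormedSpace ℂ H]

/-- A product rule for families that are only strongly continuous: split `V_s z(s) = V_s z(t) + V_s
(z(s) - z(t))` and apply joint continuity to the difference quotient of the second term. -/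
theorem hasDerivAt_isometry_apply {V : ℝ → H →ₗᵢ[ℂ] H} (hV : ∀ x, Continuous fun t => V t x)
    {z : ℝ → H} {z' y : H} {t : ℝ} (hz : HasDerivAt z z' t)
    (hy : HasDerivAt (fun s => V s (z t)) y t) :
    HasDerivAt (fun s => V s (z s)) (y + V t z') t := by
  have h1 : HasDerivAt (fun s => V s (z s - z t)) (V t z') t := by
    rw [hasDerivAt_iff_tendsto_slope] at hz ⊢
    have h2 : Filter.Tendsto (fun s => (s, slope z t s)) (nhdsWithin t {t}ᶜ) (nhds (t, z')) :=
      (Filter.tendsto_id.mono_left nhdsWithin_le_nhds).prodMk_nhds hz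
    refine (((continuous_isometry_uncurry hV).tendsto (t, z')).comp h2).congr fun s => ?_
    simp only [Function.comp_apply, slope_def_module, sub_self, map_zero, sub_zero]
    exact (V s).toLinearMap.map_smul_of_tower _ _
  refine (hy.add h1).congr_of_eventuallyEq (Filter.Eventually.of_forall fun s => ?_)
  simp

namespace IsUnitaryGroupOf

variable {P : H →ₗ.[ℂ] H} {U : ℝ → H →ₗᵢ[ℂ] H} (hU : IsUnitaryGroupOf P U)
include hU

theorem apply_neg_apply (t : ℝ) (x : H) : U t (U (-t) x) = x := by
  rw [← hU.add, add_neg_cancel, hU.zero]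

theorem continuous_neg (x : H) : Continuous fun t => U (-t) x :=
  (hU.continuous x).comp continuous_id.neg

theorem continuous_neg_apply {F : ℝ → H} (hF : Continuous F) : Continuous fun s => U (-s) (F s) :=
  (continuous_isometry_uncurry hU.continuous).comp (continuous_id.neg.prodMk hF)

theorem hasDerivAt_neg {p : H × H} (hp : p ∈ P.graph) (t : ℝ) :
    HasDerivAt (fun t => U (-t) p.1) (Complex.I • U (-t) p.2) t := by
  refine ((hU.hasDerivAt p hp (-t)).scomp t (_root_.hasDerivAt_neg t)).congr_deriv ?_
  simp

variable [CompleteSpace H]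

/-- `U_{-s}` is an integrating factor: in the derivative of `U_{-s} u(s)` the terms with `iP u`
cancel. -/
theorem eq_of_solvesCauchy {f u : ℝ → H} {g : H} (hf : Continuous f) (hu : SolvesCauchy P f g u)
    (t : ℝ) : u t = U t (g + ∫ s in (0 : ℝ)..t, U (-s) (f s)) := by
  have hd (s : ℝ) : HasDerivAt (fun s => U (-s) (u s)) (U (-s) (f s)) s := by
    obtain ⟨hs, u', hu', heq⟩ := hu.1 s
    refine (hasDerivAt_isometry_apply hU.continuous_neg hu'
      (hU.hasDerivAt_neg (P.mem_graph ⟨u s, hs⟩) s)).congr_deriv ?_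
    rw [← heq, map_add, map_smul, add_comm]
  have hint := intervalIntegral.integral_eq_sub_of_hasDerivAt (a := 0) (b := t)
    (fun s _ => hd s) ((hU.continuous_neg_apply hf).intervalIntegrable _ _)
  rw [neg_zero, hU.zero, hu.2] at hint
  rw [hint, add_sub_cancel, hU.apply_neg_apply]

theorem apply_integral {f : ℝ → H} (hf : Continuous f) (t : ℝ) :
    U t (∫ s in (0 : ℝ)..t, U (-s) (f s)) = ∫ s in (0 : ℝ)..t, U (t - s) (f s) := by
  have h1 := (U t).toContinuousLinearMap.intervalIntegral_comp_comm
    ((hU.continuous_neg_apply hf).intervalIntegrable (μ := MeasureTheory.volume) 0 t)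
  refine h1.symm.trans (intervalIntegral.integral_congr fun s _ => ?_)
  change U t (U (-s) (f s)) = _
  rw [← hU.add, sub_eq_add_neg]

theorem intervalIntegrable {f : ℝ → H} (hf : Continuous f) (t : ℝ) :
    IntervalIntegrable (fun s => U (t - s) (f s)) MeasureTheory.volume 0 t := by
  refine Continuous.intervalIntegrable ?_ _ _
  exact (continuous_isometry_uncurry hU.continuous).comp
    ((continuous_const.sub continuous_id).prodMk hf)

omit hU in
/-- The function `t ↦ U_t g + ∫₀ᵗ U_{t-s} f(s) ds`. -/
noncomputable def duhamel (U : ℝ → H →ₗᵢ[ℂ] H) (f : ℝ → H) (g : H) (t : ℝ) : H :=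
  -- With `U_t` factored out, the integrand no longer depends on `t` and the product rule applies.
  U t (g + ∫ s in (0 : ℝ)..t, U (-s) (f s))

theorem hasDerivAt_primitive {f : ℝ → H} (hf : Continuous f) (g : H) (t : ℝ) :
    HasDerivAt (fun t => g + ∫ s in (0 : ℝ)..t, U (-s) (f s)) (U (-t) (f t)) t :=
  ((hU.continuous_neg_apply hf).integral_hasStrictDerivAt 0 t).hasDerivAt.const_add g

theorem continuous_duhamel {f : ℝ → H} (hf : Continuous f) (g : H) :
    Continuous (duhamel U f g) := by
  refine (continuous_isometry_uncurry hU.continuous).comp (continuous_id.prodMk ?_)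
  exact continuous_iff_continuousAt.mpr fun t => (hU.hasDerivAt_primitive hf g t).continuousAt

/-- The graph of a closed operator is a Banach space, so the pair of integrands can be integrated
inside it. -/
theorem primitive_mem_graph (hP : P.IsClosed) {f f' : ℝ → H} (hf : Continuous f)
    (hf' : Continuous f') (hff' : ∀ t, (f t, f' t) ∈ P.graph) {g g' : H}
    (hg : (g, g') ∈ P.graph) (t : ℝ) :
    (g + ∫ s in (0 : ℝ)..t, U (-s) (f s), g' + ∫ s in (0 : ℝ)..t, U (-s) (f' s)) ∈ P.graph := by
  have : CompleteSpace P.graph := hP.completeSpace_coe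
  let p : ℝ → P.graph := fun s => ⟨(U (-s) (f s), U (-s) (f' s)), hU.mem_graph (-s) _ (hff' s)⟩
  have hp : Continuous p :=
    ((hU.continuous_neg_apply hf).prodMk (hU.continuous_neg_apply hf')).subtype_mk _
  have hint : IntervalIntegrable p MeasureTheory.volume 0 t := hp.intervalIntegrable _ _
  have h1 := (ContinuousLinearMap.fst ℂ H H ∘L P.graph.subtypeL).intervalIntegral_comp_comm hint
  have h2 := (ContinuousLinearMap.snd ℂ H H ∘L P.graph.subtypeL).intervalIntegral_comp_comm hint
  have h3 : (∫ s in (0 : ℝ)..t, U (-s) (f s), ∫ s in (0 : ℝ)..t, U (-s) (f' s)) =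
      ((∫ s in (0 : ℝ)..t, p s : P.graph) : H × H) := Prod.ext h1 h2
  have h4 := add_mem hg (∫ s in (0 : ℝ)..t, p s : P.graph).2
  rwa [← h3] at h4

theorem duhamel_mem_graph (hP : P.IsClosed) {f f' : ℝ → H} (hf : Continuous f)
    (hf' : Continuous f') (hff' : ∀ t, (f t, f' t) ∈ P.graph) {g g' : H}
    (hg : (g, g') ∈ P.graph) (t : ℝ) : (duhamel U f g t, duhamel U f' g' t) ∈ P.graph :=
  hU.mem_graph t _ (hU.primitive_mem_graph hP hf hf' hff' hg t)

theorem hasDerivAt_duhamel (hP : P.IsClosed) {f f' : ℝ → H} (hf : Continuous f)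
    (hf' : Continuous f') (hff' : ∀ t, (f t, f' t) ∈ P.graph) {g g' : H}
    (hg : (g, g') ∈ P.graph) (t : ℝ) :
    HasDerivAt (duhamel U f g) (f t - Complex.I • duhamel U f' g' t) t := by
  refine (hasDerivAt_isometry_apply hU.continuous (hU.hasDerivAt_primitive hf g t)
    (hU.hasDerivAt _ (hU.primitive_mem_graph hP hf hf' hff' hg t) t)).congr_deriv ?_
  rw [hU.apply_neg_apply, duhamel]
  abel

/-- Writing `u_l` for the Duhamel function of `f_l, g_l`, one has `u_l' = f_l - i u_{l+1}`: each
derivative uses up one level of the tower. -/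
theorem contDiff_duhamel (hP : P.IsClosed) {k : ℕ} {f : ℕ → ℝ → H} {g : ℕ → H}
    (hf : ∀ l < k, ∀ t, (f l t, f (l + 1) t) ∈ P.graph)
    (hfc : ∀ l ≤ k, ContDiff ℝ (k - 1 : ℕ) (f l))
    (hg : ∀ l < k, (g l, g (l + 1)) ∈ P.graph) :
    ∀ j ≤ k, ∀ l ≤ k - j, ContDiff ℝ j (duhamel U (f l) (g l))
  | 0, _, l, hl => by
    rw [Nat.cast_zero, contDiff_zero]
    exact hU.continuous_duhamel (hfc l hl).continuous _
  | j + 1, hj, l, hl => by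
    have hd := hU.hasDerivAt_duhamel hP (hfc l (by omega)).continuous
      (hfc (l + 1) (by omega)).continuous (hf l (by omega)) (hg l (by omega))
    push_cast
    rw [contDiff_succ_iff_deriv]
    refine ⟨fun t => (hd t).differentiableAt, by simp, ?_⟩
    rw [show deriv _ = _ from funext fun t => (hd t).deriv]
    refine ((hfc l (by omega)).of_le ?_).sub
      ((contDiff_duhamel hP hf hfc hg j (by omega) (l + 1) (by omega)).const_smul Complex.I)
    -- For `u_l` to be `C^{j+1}`, `f_l` need only be `C^j`, and `j + 1 ≤ k`; hence `C^{k-1}` data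
    -- suffice.
    exact_mod_cast (by omega : j ≤ k - 1)

end IsUnitaryGroupOf

end Cauchy

end HilbertModule

theorem mainTheorem2 {A : Type*} [NonUnitalCStarAlgebra A] [PartialOrder A] [StarOrderedRing A]
    {H : Type*} [NormedAddCommGroup H] [NormedSpace ℂ H] [CompleteSpace H] [SMul A H]
    [CStarModule A H] (P : H →ₗ.[ℂ] H) (hP : HilbertModule.IsRegular A P)
    (hPsa : HilbertModule.IsSelfAdjoint A P) (k : ℕ) (hk : 0 < k)
    (f : ℝ → H) (hf : HilbertModule.MemC A P (k - 1) k f)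
    (g : H) (hg : g ∈ (HilbertModule.ppow P k).domain) :
    (∃! u : ℝ → H, (∀ j ≤ k, HilbertModule.MemC A P j (k - j) u) ∧
      HilbertModule.SolvesCauchy P f g u) ∧
    ∀ u : ℝ → H, (∀ j ≤ k, HilbertModule.MemC A P j (k - j) u) →
      HilbertModule.SolvesCauchy P f g u →
      ∀ t : ℝ,
        IntervalIntegrable (fun s => HilbertModule.expNegI A P (t - s) (f s))
          MeasureTheory.volume 0 t ∧
        u t = HilbertModule.expNegI A P t g +
          ∫ s in (0 : ℝ)..t, HilbertModule.expNegI A P (t - s) (f s) := by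
  have hcalc := HilbertModule.isFunctionalCalculus_functionalCalculus hP hPsa
  have hU := hcalc.isUnitaryGroupOf
  have hexp := HilbertModule.expNegI_eq_of_isNondegenerateRep hcalc.rep
  -- `F l` and, below, `G l` stand for `P^l f` and `P^l g`.
  obtain ⟨F, rfl, hF, hFc⟩ := hf.exists_tower
  obtain ⟨G, rfl, hG⟩ := HilbertModule.exists_tower_of_mem_domain hg
  have hfc : Continuous (F 0) := (hFc 0 (Nat.zero_le k)).continuous
  have hmem (l : ℕ) (hl : l < k) := hU.duhamel_mem_graph hP.isClosed (hFc l hl.le).continuous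
    (hFc (l + 1) hl).continuous (hF l hl) (hG l hl)
  refine ⟨⟨HilbertModule.IsUnitaryGroupOf.duhamel hcalc.rep.expIsometry (F 0) (G 0),
    ⟨fun j hj => ?_, fun t => ?_, ?_⟩, ?_⟩, ?_⟩
  · exact HilbertModule.memC_of_tower hP.isClosed
      (w := fun l => HilbertModule.IsUnitaryGroupOf.duhamel hcalc.rep.expIsometry (F l) (G l))
      (fun l hl t => hmem l (by omega) t)
      (hU.contDiff_duhamel hP.isClosed hF hFc hG j hj)
  · obtain ⟨x, hx, hx'⟩ := (LinearPMap.mem_graph_iff P).mp (hmem 0 hk t)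
    simp only at hx hx'
    refine ⟨hx ▸ x.2, _, hU.hasDerivAt_duhamel hP.isClosed hfc
      (hFc 1 hk).continuous (hF 0 hk) (hG 0 hk) t, ?_⟩
    have h1 : (⟨_, hx ▸ x.2⟩ : P.domain) = x := Subtype.ext hx.symm
    rw [h1, hx', sub_add_cancel]
  · simp [HilbertModule.IsUnitaryGroupOf.duhamel, hU.zero]
  · rintro u ⟨-, hu⟩
    exact funext fun t => hU.eq_of_solvesCauchy hfc hu t
  · intro u _ hu t
    simp only [hexp]
    refine ⟨hU.intervalIntegrable hfc t, ?_⟩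
    -- Moving `U_t` under the integral turns `U_t U_{-s}` into `U_{t-s} = e^{i(s-t)P}`.
    rw [hU.eq_of_solvesCauchy hfc hu t, map_add, hU.apply_integral hfc]
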